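/- Let $\Omega\subset\mathbb{R}^2$ be a simply connected open set containing the origin $O$. Let $\boldsymbol{E}=(E_{ij})\in\mathcal{D}'(\Omega,\operatorname{Sym})$ be a distribution on $\Omega$ with values in the symmetric $2\times 2$ tensors ($E_{ij}=E_{ji}\in\mathcal{D}'(\Omega)$) whose singular support is contained in $\{O\}$. For a vector field $\boldsymbol{v}$ put $\operatorname{curl}\boldsymbol{v}=\partial_1v_2-\partial_2v_1$, and for a tensor field $\boldsymbol{V}$ let $\operatorname{curl}\boldsymbol{V}$ be the vector field with components $(\operatorname{curl}\boldsymbol{V})_i=\partial_1V_{i2}-\partial_2V_{i1}$; write $\operatorname{Curl}$ for the same operators on distributions. Let $B_\epsilon$ be the open ball of radius $\epsilon$ centred at $O$. The degree of divergence of $\boldsymbol{E}$ at $O$ is $$\deg\boldsymbol{E}=\inf\Big\{k\in\mathbb{R} : \lim_{\lambda\to0^+}\lambda^kE_{ij}(\phi_\lambda)=0\ \text{for all } i,j \text{ and all } \phi\in\mathcal{D}(B_r)\Big\}-2\in[-\infty,\infty],\qquad \phi_\lambda(\boldsymbol{x})=\lambda^{-2}\phi(\boldsymbol{x}/\lambda),$$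 where $B_r\subset\Omega$ (the value does not depend on $r$). Then $\boldsymbol{E}|_{\Omega-O}$ is represented by a smooth map $\boldsymbol{E}_0:\Omega-O\to\operatorname{Sym}$, and for every $\epsilon>0$ with $\overline{B_\epsilon}\subset\Omega$ the following hold. Consider the three conditions (C) $\operatorname{Curl}\operatorname{Curl}\boldsymbol{E}=0$ in $\mathcal{D}'(\Omega)$ (strain compatibility); (i) $\operatorname{curl}\operatorname{curl}\boldsymbol{E}_0=0$ on $\Omega-O$; (ii) for all $\boldsymbol{x}\in\Omega-O$, $$\oint_{\partial B_\epsilon}\{\boldsymbol{E}_0(\boldsymbol{y})+(\boldsymbol{y}-\boldsymbol{x})\times\operatorname{curl}\boldsymbol{E}_0(\boldsymbol{y})\}\,d\boldsymbol{y}=\boldsymbol{0},$$ where $\boldsymbol{v}\times\boldsymbol{w}$ denotes the tensor $(v_2\boldsymbol{e}_1-v_1\boldsymbol{e}_2)\otimes\boldsymbol{w}$, tensors are applied to $d\boldsymbol{y}$, and $\partial B_\epsilon$ is traversed once counterclockwise. (a) (C) implies (i) and (ii). (b) If $\deg\boldsymbol{E}<-2$, then (C) is equivalent to (i). (c) If $-2\le\deg\boldsymbol{E}<0$,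 then (C) is equivalent to (i) and (ii) together. -/

import Mathlib

open Set Filter Topology TopologicalSpace MeasureTheory
open scoped Distributions LineDeriv ContDiff

namespace PlanarStrain

/-- The Euclidean plane. The distinguished point `O` is the origin. -/
abbrev Plane := EuclideanSpace ℝ (Fin 2)

/-- The vectors `e₁`, `e₂` of the standard basis, indexed by `0` and `1`. -/
noncomputable def basisVec (i : Fin 2) : Plane := EuclideanSpace.single i 1

/-- `W - O` as an open set. -/
def puncture (W : Opens Plane) : Opens Plane := W ⊓ ⟨{0}ᶜ, isOpen_compl_singleton⟩

/-- The open ball `B_r` centred at the origin. -/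
def originBall (r : ℝ) : Opens Plane := ⟨Metric.ball 0 r, Metric.isOpen_ball⟩

/-- `ℝ²`-valued distributions on `Ω`, given by their components. -/
abbrev VectorDistribution (Ω : Opens Plane) := Fin 2 → 𝓓'(Ω, ℝ)

/-- `Lin`-valued distributions on `Ω`, given by their components `T i j`; the pairing with a
tensor test function `φ` is `∑ i j, T i j (φ i j)`. A `Sym`-valued distribution is one that
satisfies `Matrix.IsSymm`. -/
abbrev TensorDistribution (Ω : Opens Plane) := Matrix (Fin 2) (Fin 2) 𝓓'(Ω, ℝ)

/-- The restriction `T|_W` of a distribution on `Ω` to an open subset `W` of `Ω`: test functions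
on `W` are extended by zero. (It is only used for `W ≤ Ω`.) -/
noncomputable def restriction {Ω : Opens Plane} (W : Opens Plane) (T : 𝓓'(Ω, ℝ)) : 𝓓'(W, ℝ) :=
  (TestFunction.monoCLM ℝ : 𝓓(W, ℝ) →L[ℝ] 𝓓(Ω, ℝ)).precompCompactConvergenceCLM ℝ T

/-! ### Differential operators on distributions -/

/-- `Curl v = ∂₁ v₂ - ∂₂ v₁`, where `∂ᵢ T (ψ) = - T (∂ᵢ ψ)`. -/
noncomputable def distCurl {Ω : Opens Plane} (v : VectorDistribution Ω) : 𝓓'(Ω, ℝ) :=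
  ∂_{basisVec 0} (v 1) - ∂_{basisVec 1} (v 0)

/-- `⟨Curl V, a⟩ = Curl (Vᵀ a)`: the curl of each row of `V`. -/
noncomputable def distCurlTensor {Ω : Opens Plane} (V : TensorDistribution Ω) :
    VectorDistribution Ω :=
  fun i => distCurl (V i)

/-- `Curl Curl V`. -/
noncomputable def distCurlCurl {Ω : Opens Plane} (V : TensorDistribution Ω) : 𝓓'(Ω, ℝ) :=
  distCurl (distCurlTensor V)

/-! ### Differential operators on smooth maps -/

/-- The partial derivative `∂f/∂xᵢ`. -/
noncomputable def partialDeriv (i : Fin 2) (f : Plane → ℝ) (x : Plane) : ℝ :=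
  fderiv ℝ f x (basisVec i)

/-- `curl f = ∂f₂/∂x₁ - ∂f₁/∂x₂`. -/
noncomputable def curl (f : Plane → Fin 2 → ℝ) (x : Plane) : ℝ :=
  partialDeriv 0 (fun y => f y 1) x - partialDeriv 1 (fun y => f y 0) x

/-- `⟨curl F, a⟩ = curl (Fᵀ a)`: the curl of each row of `F`. -/
noncomputable def curlTensor (F : Plane → Matrix (Fin 2) (Fin 2) ℝ) (x : Plane) : Fin 2 → ℝ :=
  fun i => curl (fun y => F y i) x

/-- `curl curl F`. -/
noncomputable def curlCurl (F : Plane → Matrix (Fin 2) (Fin 2) ℝ) (x : Plane) : ℝ :=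
  curl (curlTensor F) x

/-! ### Singular support and singular fields -/

/-- `f` is a smooth function on `U` that represents the distribution `T` on `U`. -/
def IsSmoothDensity {U : Opens Plane} (T : 𝓓'(U, ℝ)) (f : Plane → ℝ) : Prop :=
  ContDiffOn ℝ ∞ f (U : Set Plane) ∧
    ∀ ψ : 𝓓(U, ℝ), T ψ = ∫ x in (U : Set Plane), f x * ψ x

/-- A smooth distribution. -/
def IsSmooth {U : Opens Plane} (T : 𝓓'(U, ℝ)) : Prop := ∃ f : Plane → ℝ, IsSmoothDensity T f

/-- `T` is smooth at `x`: its restriction to some open neighbourhood of `x` is smooth. -/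
def IsSmoothAt {Ω : Opens Plane} (T : 𝓓'(Ω, ℝ)) (x : Plane) : Prop :=
  ∃ W : Opens Plane, x ∈ W ∧ W ≤ Ω ∧ IsSmooth (restriction W T)

/-- The singular support: the closure in `Ω` of the set of points where `T` is not smooth. -/
def singSupport {Ω : Opens Plane} (T : 𝓓'(Ω, ℝ)) : Set Plane :=
  (Ω : Set Plane) ∩ closure {x | x ∈ Ω ∧ ¬ IsSmoothAt T x}

/-- The class `𝒜(Ω, Lin)`: the singular support of every component lies in `{O}`. -/
def IsSingularField {Ω : Opens Plane} (E : TensorDistribution Ω) : Prop :=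
  ∀ i j, singSupport (E i j) ⊆ {0}

/-- `E₀` is the smooth map on `Ω - O` that represents `E|_{Ω - O}`. (Its values elsewhere are
irrelevant.) -/
def IsRegularPart {Ω : Opens Plane} (E : TensorDistribution Ω)
    (E₀ : Plane → Matrix (Fin 2) (Fin 2) ℝ) : Prop :=
  ∀ i j, IsSmoothDensity (restriction (puncture Ω) (E i j)) (fun x => E₀ x i j)

/-! ### Scaling degree and degree of divergence -/

/-- For `0 < lam ≤ 1` the support of `x ↦ lam⁻² φ (x / lam)` is again a compact subset of the
ball. -/
theorem rescale_aux {r lam : ℝ} (h : 0 < lam ∧ lam ≤ 1) (φ : 𝓓(originBall r, ℝ)) :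
    ContDiff ℝ ∞ (fun x : Plane => (lam ^ 2)⁻¹ * φ (lam⁻¹ • x)) ∧
      HasCompactSupport (fun x : Plane => (lam ^ 2)⁻¹ * φ (lam⁻¹ • x)) ∧
      tsupport (fun x : Plane => (lam ^ 2)⁻¹ * φ (lam⁻¹ • x)) ⊆ (originBall r : Set Plane) := by
  have hne : lam⁻¹ ≠ 0 := inv_ne_zero h.1.ne'
  have hc : HasCompactSupport (fun x : Plane => φ (lam⁻¹ • x)) :=
    φ.hasCompactSupport.comp_homeomorph (Homeomorph.smulOfNeZero lam⁻¹ hne)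
  have hs : tsupport (fun x : Plane => φ (lam⁻¹ • x)) ⊆ (fun x => lam⁻¹ • x) ⁻¹' tsupport φ :=
    closure_minimal (fun x hx => subset_tsupport φ hx)
      ((isClosed_tsupport _).preimage (continuous_const_smul _))
  refine ⟨contDiff_const.mul (φ.contDiff.comp (contDiff_const_smul _)), hc.mul_left, ?_⟩
  refine (tsupport_mul_subset_right).trans (hs.trans ?_)
  intro x hx
  have h1 : lam⁻¹ • x ∈ Metric.ball (0 : Plane) r := φ.tsupport_subset hx
  rw [mem_ball_zero_iff, norm_smul, norm_inv, Real.norm_of_nonneg h.1.le] at h1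
  have h2 : ‖x‖ ≤ lam⁻¹ * ‖x‖ :=
    le_mul_of_one_le_left (norm_nonneg x) ((one_le_inv₀ h.1).2 h.2)
  exact mem_ball_zero_iff.2 (h2.trans_lt h1)

open Classical in
/-- The rescaled test function `φ_lam (x) = lam⁻² φ (x / lam)` on the ball `B_r`, for
`0 < lam ≤ 1` (and zero for other `lam`, which are never used). -/
noncomputable def rescale {r : ℝ} (lam : ℝ) (φ : 𝓓(originBall r, ℝ)) : 𝓓(originBall r, ℝ) :=
  if h : 0 < lam ∧ lam ≤ 1 then
    ⟨fun x => (lam ^ 2)⁻¹ * φ (lam⁻¹ • x), (rescale_aux h φ).1, (rescale_aux h φ).2.1,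
      (rescale_aux h φ).2.2⟩
  else 0

/-- `lim_{lam → 0+} lam ^ k (T|_{B_r})_lam = 0` in the sense of distributions, where
`(T|_{B_r})_lam (φ) = T|_{B_r} (φ_lam)` and `B_r ⊆ Ω`. This does not depend on the choice of the
ball. -/
def ScalesToZero {Ω : Opens Plane} (T : 𝓓'(Ω, ℝ)) (k : ℝ) : Prop :=
  ∃ r : ℝ, 0 < r ∧ originBall r ≤ Ω ∧ ∀ φ : 𝓓(originBall r, ℝ),
    Tendsto (fun lam : ℝ => lam ^ k * restriction (originBall r) T (rescale lam φ))
      (𝓝[>] 0) (𝓝 0)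

/-- The scaling degree of a tensor-valued distribution at the origin: the infimum of the set of
real `k` with `lam ^ k E_lam → 0`, that is, with `lam ^ k (E i j)_lam → 0` for all components. It
is `⊥` if the set is not bounded below. -/
noncomputable def scalingDegree {Ω : Opens Plane} (E : TensorDistribution Ω) : EReal :=
  sInf ((fun k : ℝ => (k : EReal)) '' {k | ∀ i j, ScalesToZero (E i j) k})

/-- The degree of divergence `deg E = sd E - 2`; two is the dimension of the plane. -/
noncomputable def degree {Ω : Opens Plane} (E : TensorDistribution Ω) : EReal :=
  scalingDegree E - ((2 : ℝ) : EReal)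

/-! ### The Cesàro loop integral -/

/-- The point of the circle `∂B_ε` with polar angle `θ`. -/
noncomputable def circlePoint (ε θ : ℝ) : Plane := !₂[ε * Real.cos θ, ε * Real.sin θ]

/-- The derivative of `circlePoint ε` with respect to the polar angle. -/
noncomputable def circleVelocity (ε θ : ℝ) : Fin 2 → ℝ := ![-(ε * Real.sin θ), ε * Real.cos θ]

/-- `v × e₃ = v₂ e₁ - v₁ e₂`. -/
def crossE₃ (v : Plane) : Fin 2 → ℝ := ![v 1, -(v 0)]

/-- The Cesàro integrand `F(y) + (y - x) × curl F(y)`, a second order tensor. Here `curl F` stands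
for the row curl `e₃ ⊗ curl F` of a planar field, so that `v × (e₃ ⊗ w) = (v × e₃) ⊗ w`. -/
noncomputable def cesaroIntegrand (F : Plane → Matrix (Fin 2) (Fin 2) ℝ) (x y : Plane) :
    Matrix (Fin 2) (Fin 2) ℝ :=
  F y + Matrix.vecMulVec (crossE₃ (y - x)) (curlTensor F y)

/-- The line integral `∮_{∂B_ε} {F(y) + (y - x) × curl F(y)} dy`, a vector; the circle is traversed
once, counterclockwise. -/
noncomputable def cesaroIntegral (F : Plane → Matrix (Fin 2) (Fin 2) ℝ) (ε : ℝ) (x : Plane) :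
    Fin 2 → ℝ :=
  fun i => ∫ θ in (0 : ℝ)..(2 * Real.pi),
    (cesaroIntegrand F x (circlePoint ε θ)).mulVec (circleVelocity ε θ) i

/-- `curl curl (E|_{Ω - O}) = 0` on `Ω - O`, for the smooth representative `F`. -/
def IsCurlCurlFree (Ω : Opens Plane) (F : Plane → Matrix (Fin 2) (Fin 2) ℝ) : Prop :=
  ∀ x ∈ puncture Ω, curlCurl F x = 0

/-- The Cesàro integral over `∂B_ε` vanishes for all base points `x ∈ Ω - O`. -/
def CesaroVanishes (Ω : Opens Plane) (F : Plane → Matrix (Fin 2) (Fin 2) ℝ) (ε : ℝ) : Prop :=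
  ∀ x ∈ puncture Ω, cesaroIntegral F ε x = 0

end PlanarStrain

namespace PlanarStrain

/-! Write T for the distribution Curl Curl E. Off the origin T has the smooth density curl curl E₀,
so (i) says exactly that T is supported at O (`IsRegularPart.isCurlCurlFree_iff`). What remains is
to decide when such a T vanishes.

Two facts bound T. It has finite order, so it annihilates test functions that are flat enough at O
(`exists_order_apply_eq_zero`). It also inherits scaling from E: each derivative of a rescaled test
function costs one factor of 1/lam, so exponent k for E gives k + 2 for T
(`scalesToZero_distCurlCurl`). Together they show that a T scaling to zero with exponent at most 2 +
d sees only the derivatives of order less than d at O (`ScalesToZero.apply_eq_zero`). If deg E < -2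
then d = 0 works and T = 0. If deg E < 0 then d = 2 works, and T is determined by its moments T(χ),
T(x₁χ), T(x₂χ) for a cutoff χ equal to one near O (`eq_zero_of_moments`).

These moments are loop integrals. Moving derivatives onto χ leaves test functions that vanish near
O, so only E₀ enters. Given (i), curl E₀ and the rows of the Cesàro integrand with base point O are
closed one-forms on Ω - O, and Green's theorem on an annulus turns their pairing with dχ into
circulations around the circle (`IsCutoff.integral_wedge`). The Cesàro integral is affine in the
base point, with these circulations as coefficients; hence (ii) says that the three moments vanish
(`IsRegularPart.cesaroVanishes_iff_moments`). For T = 0 all moments vanish, which gives necessity at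
any degree. -/

/-! ### Test functions, restriction and smooth densities -/

/-- A test function on `W`, extended by zero to `Ω ≥ W`. -/
noncomputable def extend {W Ω : Opens Plane} (h : W ≤ Ω) (ψ : 𝓓(W, ℝ)) : 𝓓(Ω, ℝ) :=
  ⟨ψ, ψ.contDiff, ψ.hasCompactSupport, ψ.tsupport_subset.trans h⟩

@[simp] lemma extend_apply {W Ω : Opens Plane} (h : W ≤ Ω) (ψ : 𝓓(W, ℝ)) (x : Plane) :
    extend h ψ x = ψ x := rfl

lemma restriction_apply {W Ω : Opens Plane} (h : W ≤ Ω) (T : 𝓓'(Ω, ℝ)) (ψ : 𝓓(W, ℝ)) :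
    restriction W T ψ = T (extend h ψ) := by
  change T (TestFunction.monoCLM ℝ ψ) = _
  congr 1
  ext x
  simp [h]

/-- The product of a smooth function and a test function, as a test function on an open set that
contains its support. -/
noncomputable def cutoff {U : Opens Plane} (W : Opens Plane) (ρ : Plane → ℝ) (hρ : ContDiff ℝ ∞ ρ) (ψ : 𝓓(U, ℝ))
    (h : tsupport (fun x => ρ x * ψ x) ⊆ W) : 𝓓(W, ℝ) :=
  ⟨fun x => ρ x * ψ x, hρ.mul ψ.contDiff, ψ.hasCompactSupport.mul_left, h⟩

@[simp] lemma cutoff_apply {U W : Opens Plane} (ρ : Plane → ℝ) (hρ : ContDiff ℝ ∞ ρ) (ψ : 𝓓(U, ℝ))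
    (h : tsupport (fun x => ρ x * ψ x) ⊆ W) (x : Plane) :
    cutoff W ρ hρ ψ h x = ρ x * ψ x := rfl

lemma testFunction_sum_apply {ι : Type*} {U : Opens Plane} (t : Finset ι) (ψ : ι → 𝓓(U, ℝ))
    (x : Plane) : (∑ i ∈ t, ψ i) x = ∑ i ∈ t, ψ i x := by
  classical
  induction t using Finset.induction_on with
  | empty => simp
  | insert i t hi ih => rw [Finset.sum_insert hi, Finset.sum_insert hi, ← ih]; rfl

lemma setIntegral_mul_testFunction {U : Opens Plane} (f : Plane → ℝ) (ψ : 𝓓(U, ℝ)) :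
    ∫ x in (U : Set Plane), f x * ψ x = ∫ x, f x * ψ x := by
  refine setIntegral_eq_integral_of_forall_compl_eq_zero fun x hx => ?_
  rw [image_eq_zero_of_notMem_tsupport fun h => hx (ψ.tsupport_subset h), mul_zero]

/-- A continuous function on `U` that annihilates all test functions is zero. -/
lemma eq_zero_of_integral_testFunction {U : Opens Plane} {f : Plane → ℝ}
    (hf : ContinuousOn f U) (h : ∀ ψ : 𝓓(U, ℝ), ∫ x in (U : Set Plane), f x * ψ x = 0)
    {x : Plane} (hx : x ∈ U) : f x = 0 := by
  have hae : ∀ᵐ y ∂volume, y ∈ (U : Set Plane) → f y = 0 := by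
    refine U.isOpen.ae_eq_zero_of_integral_contDiff_smul_eq_zero
      (hf.locallyIntegrableOn U.isOpen.measurableSet) fun g hg hgc hgU => ?_
    have := h ⟨g, hg, hgc, hgU⟩
    rw [setIntegral_mul_testFunction] at this
    simpa [mul_comm] using this
  rw [← ae_restrict_iff' U.isOpen.measurableSet] at hae
  exact Measure.eqOn_open_of_ae_eq hae U.isOpen hf continuousOn_const hx

lemma integrable_mul_testFunction {U : Opens Plane} {f : Plane → ℝ} (hf : ContinuousOn f U)
    (ψ : 𝓓(U, ℝ)) : Integrable fun x => f x * ψ x := by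
  refine Continuous.integrable_of_hasCompactSupport ?_ ψ.hasCompactSupport.mul_left
  rw [← continuousOn_univ]
  intro x _
  by_cases hx : x ∈ tsupport ψ
  · exact ((hf.continuousAt (U.isOpen.mem_nhds (ψ.tsupport_subset hx))).mul
      ψ.continuous.continuousAt).continuousWithinAt
  · have : (fun y => f y * ψ y) =ᶠ[𝓝 x] fun _ => 0 := by
      filter_upwards [(isClosed_tsupport ψ).isOpen_compl.mem_nhds hx] with y hy
      rw [image_eq_zero_of_notMem_tsupport hy, mul_zero]
    exact (continuousAt_const.congr this.symm).continuousWithinAt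

lemma IsSmoothDensity.restrict {U : Opens Plane} {T : 𝓓'(U, ℝ)} {f : Plane → ℝ}
    (h : IsSmoothDensity T f) {W : Opens Plane} (hW : W ≤ U) :
    IsSmoothDensity (restriction W T) f := by
  refine ⟨h.1.mono hW, fun ψ => ?_⟩
  rw [restriction_apply hW, h.2, setIntegral_mul_testFunction, setIntegral_mul_testFunction]
  rfl

lemma restriction_restriction {V W Ω : Opens Plane} (hVW : V ≤ W) (hW : W ≤ Ω) (T : 𝓓'(Ω, ℝ)) :
    restriction V (restriction W T) = restriction V T := by
  ext ψ
  rw [restriction_apply hVW, restriction_apply hW, restriction_apply (hVW.trans hW)]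
  rfl

/-- Uniqueness of the smooth density is what lets local densities be glued. -/
lemma IsSmoothDensity.eqOn {U : Opens Plane} {T : 𝓓'(U, ℝ)} {f g : Plane → ℝ}
    (hf : IsSmoothDensity T f) (hg : IsSmoothDensity T g) : EqOn f g U := by
  intro x hx
  refine sub_eq_zero.1 (eq_zero_of_integral_testFunction (f := fun x => f x - g x)
    (hf.1.continuousOn.sub hg.1.continuousOn) (fun ψ => ?_) hx)
  simp_rw [setIntegral_mul_testFunction, sub_mul]
  rw [integral_sub (integrable_mul_testFunction hf.1.continuousOn ψ)
    (integrable_mul_testFunction hg.1.continuousOn ψ), ← setIntegral_mul_testFunction,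
    ← setIntegral_mul_testFunction, ← hf.2, ← hg.2, sub_self]

/-! ### Gluing local densities; existence of the regular part -/

/-- A distribution that is smooth at every point of an open set is smooth on that set. -/
theorem isSmooth_restriction_of_forall_isSmoothAt {Ω U : Opens Plane} (hU : U ≤ Ω)
    {T : 𝓓'(Ω, ℝ)} (h : ∀ x ∈ U, IsSmoothAt T x) : IsSmooth (restriction U T) := by
  classical
  have h' : ∀ x : U, ∃ (W : Opens Plane) (f : Plane → ℝ), (x : Plane) ∈ W ∧ W ≤ Ω ∧
      IsSmoothDensity (restriction W T) f := fun x => by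
    obtain ⟨W, hx, hW, f, hf⟩ := h x x.2
    exact ⟨W, f, hx, hW, hf⟩
  choose W f hx hW hf using h'
  let F : Plane → ℝ := fun x => if hx : x ∈ U then f ⟨x, hx⟩ x else 0
  -- At each point `F` takes the density chosen for that point. Any two chosen densities represent
  -- `T` on the overlap of their neighbourhoods, so they agree there, and near each point `F` is a
  -- single smooth function.
  have hF : ∀ (x : U) (y : Plane), y ∈ U → y ∈ W x → F y = f x y := by
    intro x y hy hyx
    simp only [F, hy, dif_pos]
    have h1 := (hf ⟨y, hy⟩).restrict (W := W ⟨y, hy⟩ ⊓ W x) inf_le_left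
    have h2 := (hf x).restrict (W := W ⟨y, hy⟩ ⊓ W x) inf_le_right
    rw [restriction_restriction inf_le_left (hW _)] at h1
    rw [restriction_restriction inf_le_right (hW _)] at h2
    exact h1.eqOn h2 ⟨hx ⟨y, hy⟩, hyx⟩
  have hFc : ContDiffOn ℝ ∞ F U := by
    intro x hxU
    have hs := (hf ⟨x, hxU⟩).1.contDiffAt ((W ⟨x, hxU⟩).isOpen.mem_nhds (hx _))
    refine (hs.congr_of_eventuallyEq ?_).contDiffWithinAt
    filter_upwards [U.isOpen.mem_nhds hxU, (W ⟨x, hxU⟩).isOpen.mem_nhds (hx _)] with y hy hyx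
    exact hF _ y hy hyx
  refine ⟨F, hFc, fun ψ => ?_⟩
  obtain ⟨t, ht⟩ := ψ.hasCompactSupport.isCompact.elim_finite_subcover (fun x : U => (W x : Set Plane))
    (fun x => (W x).isOpen) (fun y hy => mem_iUnion.2 ⟨⟨y, ψ.tsupport_subset hy⟩, hx _⟩)
  -- The partition is indexed by a finite subcover of the support of `ψ`, so `ψ` is a finite sum of
  -- pieces and linearity of `T` suffices. The weights need to sum to one only on that support,
  -- since elsewhere `ψ` vanishes.
  obtain ⟨ρ, hρ⟩ := SmoothPartitionOfUnity.exists_isSubordinate (modelWithCornersSelf ℝ Plane)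
    (isClosed_tsupport ψ) (fun x : t => (W x : Set Plane)) (fun x => (W x).isOpen)
    (fun y hy => by
      obtain ⟨x, hx, hy⟩ := mem_iUnion₂.1 (ht hy)
      exact mem_iUnion.2 ⟨⟨x, hx⟩, hy⟩)
  have hρs : ∀ i, ContDiff ℝ ∞ (ρ i) := fun i => (ρ i).contMDiff.contDiff
  have hsupp : ∀ i, tsupport (fun x => ρ i x * ψ x) ⊆ (U ⊓ W i : Opens Plane) := fun i =>
    subset_inter ((tsupport_mul_subset_right).trans ψ.tsupport_subset)
      ((tsupport_mul_subset_left).trans (hρ i))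
  let ψi : ∀ i : t, 𝓓((U ⊓ W i : Opens Plane), ℝ) := fun i => cutoff _ (ρ i) (hρs i) ψ (hsupp i)
  have hsum : ψ = ∑ i : t, extend inf_le_left (ψi i) := by
    ext x
    rw [testFunction_sum_apply]
    simp only [extend_apply, ψi, cutoff_apply, ← Finset.sum_mul]
    by_cases hxs : x ∈ tsupport ψ
    · have := ρ.sum_eq_one hxs
      rw [finsum_eq_sum_of_fintype] at this
      rw [this, one_mul]
    · rw [image_eq_zero_of_notMem_tsupport hxs, mul_zero]
  have hterm : ∀ i : t, restriction U T (extend inf_le_left (ψi i)) =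
      ∫ x, F x * (extend (inf_le_left : U ⊓ W i ≤ U) (ψi i)) x := fun i => by
    have h1 : restriction U T (extend inf_le_left (ψi i)) =
        restriction (W i) T (extend inf_le_right (ψi i)) := by
      rw [restriction_apply hU, restriction_apply (hW _)]
      rfl
    rw [h1, (hf i).2, setIntegral_mul_testFunction]
    refine integral_congr_ae (Eventually.of_forall fun x => ?_)
    by_cases hxs : x ∈ tsupport (ψi i)
    · have := (ψi i).tsupport_subset hxs
      simp only [extend_apply]
      rw [hF i x this.1 this.2]
    · simp [image_eq_zero_of_notMem_tsupport hxs]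
  rw [setIntegral_mul_testFunction]
  conv_lhs => rw [hsum, map_sum]
  simp_rw [hterm]
  rw [← integral_finsetSum]
  · refine integral_congr_ae (Eventually.of_forall fun x => ?_)
    conv_rhs => rw [hsum]
    simp only [testFunction_sum_apply, Finset.mul_sum]
  · exact fun i _ => integrable_mul_testFunction hFc.continuousOn _

lemma puncture_le (Ω : Opens Plane) : puncture Ω ≤ Ω := inf_le_left

lemma isSmoothAt_of_notMem_singSupport {Ω : Opens Plane} {T : 𝓓'(Ω, ℝ)} {x : Plane} (hx : x ∈ Ω)
    (h : x ∉ singSupport T) : IsSmoothAt T x := by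
  by_contra hs
  exact h ⟨hx, subset_closure ⟨hx, hs⟩⟩

theorem exists_isRegularPart {Ω : Opens Plane} {E : TensorDistribution Ω} (hE : IsSingularField E) :
    ∃ E₀ : Plane → Matrix (Fin 2) (Fin 2) ℝ, IsRegularPart E E₀ := by
  have : ∀ i j, IsSmooth (restriction (puncture Ω) (E i j)) := fun i j =>
    isSmooth_restriction_of_forall_isSmoothAt (puncture_le Ω) fun x hx =>
      isSmoothAt_of_notMem_singSupport hx.1 fun h => hx.2 (hE i j h)
  choose f hf using this
  exact ⟨fun x => Matrix.of fun i j => f i j x, hf⟩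

/-! ### Finite order and distributions supported at the origin -/

/-- A distribution has finite order on every compact set. -/
theorem exists_order {Ω : Opens Plane} (T : 𝓓'(Ω, ℝ)) (K : Compacts Plane)
    (hK : (K : Set Plane) ⊆ Ω) :
    ∃ (N : ℕ) (C : ℝ), ∀ ψ : 𝓓(Ω, ℝ), tsupport ψ ⊆ K → ∀ M, 0 ≤ M →
      (∀ i ≤ N, ∀ x, ‖iteratedFDeriv ℝ i ψ x‖ ≤ M) → |T ψ| ≤ C * M := by
  -- On functions supported in a fixed compact set the topology comes from the sup seminorms of the
  -- derivatives. Continuity gives a bound by finitely many of them, and `N` is the largest order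
  -- that occurs.
  let S : 𝓓_{K}(Plane, ℝ) →L[ℝ] ℝ :=
    (show 𝓓(Ω, ℝ) →L[ℝ] ℝ from T).comp (TestFunction.ofSupportedInCLM ℝ hK)
  obtain ⟨s, C, -, hC⟩ := Seminorm.bound_of_continuous
    (ContDiffMapSupportedIn.withSeminorms ℝ Plane ℝ ⊤ K)
    ((normSeminorm ℝ ℝ).comp S.toLinearMap) (continuous_norm.comp S.continuous)
  refine ⟨s.sup id, C, fun ψ hψ M hM h => ?_⟩
  let φ : 𝓓_{K}(Plane, ℝ) := .of_support_subset ψ.contDiff ((subset_tsupport ψ).trans hψ)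
  have h1 : |T ψ| ≤ C * (s.sup (ContDiffMapSupportedIn.seminorm ℝ Plane ℝ ⊤ K)) φ := hC φ
  refine h1.trans (mul_le_mul_of_nonneg_left ?_ C.2)
  refine Seminorm.finset_sup_apply_le hM fun i hi => ?_
  rw [ContDiffMapSupportedIn.seminorm_top_le_iff ℝ hM]
  exact fun x _ => h i (Finset.le_sup (f := id) hi) x

lemma iteratedFDeriv_comp_smul {f : Plane → ℝ} (hf : ContDiff ℝ ∞ f) (c : ℝ) (i : ℕ) (x : Plane) :
    iteratedFDeriv ℝ i (fun y => f (c • y)) x = c ^ i • iteratedFDeriv ℝ i f (c • x) := by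
  have h := (c • ContinuousLinearMap.id ℝ Plane).iteratedFDeriv_comp_right hf x
    (i := i) (by exact_mod_cast le_top)
  have h2 : (f ∘ (c • ContinuousLinearMap.id ℝ Plane)) = fun y => f (c • y) := rfl
  rw [h2] at h
  rw [h]
  ext m
  simp [ContinuousMultilinearMap.compContinuousLinearMap_apply,
    ContinuousMultilinearMap.map_smul_univ]

lemma exists_bound_iteratedFDeriv {f : Plane → ℝ} (hf : ContDiff ℝ ∞ f) (hc : HasCompactSupport f)
    (N : ℕ) : ∃ C, 0 ≤ C ∧ ∀ i ≤ N, ∀ x, ‖iteratedFDeriv ℝ i f x‖ ≤ C := by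
  have : ∀ i : ℕ, ∃ C, ∀ x, ‖iteratedFDeriv ℝ i f x‖ ≤ C := fun i =>
    (hf.continuous_iteratedFDeriv (m := i) (by exact_mod_cast le_top)).bounded_above_of_compact_support
      (hc.iteratedFDeriv i)
  choose C hC using this
  refine ⟨∑ i ∈ Finset.range (N + 1), C i,
    Finset.sum_nonneg fun i _ => (norm_nonneg _).trans (hC i 0), fun i hi x => (hC i x).trans ?_⟩
  exact Finset.single_le_sum (f := C) (fun j _ => (norm_nonneg _).trans (hC j 0))
    (Finset.mem_range.2 (Nat.lt_succ_of_le hi))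

/-- Taylor's estimate for the derivatives of a function that vanishes to order `N` at the origin. -/
lemma exists_bound_of_flat {f : Plane → ℝ} (hf : ContDiff ℝ ∞ f) (hc : HasCompactSupport f) {N : ℕ}
    (h0 : ∀ j ≤ N, iteratedFDeriv ℝ j f 0 = 0) :
    ∃ C, 0 ≤ C ∧ ∀ j ≤ N + 1, ∀ x, ‖iteratedFDeriv ℝ j f x‖ ≤ C * ‖x‖ ^ (N + 1 - j) := by
  obtain ⟨C, hC0, hC⟩ := exists_bound_iteratedFDeriv hf hc (N + 1)
  -- Descending induction on the order of the derivative: order `N + 1` is bounded, and each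
  -- application of the mean value inequality on the ball of radius `‖x‖` gains one factor `‖x‖`,
  -- because the derivative one order lower vanishes at the origin.
  have key : ∀ m ≤ N + 1, ∀ x, ‖iteratedFDeriv ℝ (N + 1 - m) f x‖ ≤ C * ‖x‖ ^ m := by
    intro m
    induction m with
    | zero => intro _ x; simpa using hC (N + 1) le_rfl x
    | succ m ih =>
      intro hm x
      have hj : N + 1 - m = N + 1 - (m + 1) + 1 := by omega
      have hb : ∀ y ∈ Metric.closedBall (0 : Plane) ‖x‖,
          ‖fderiv ℝ (iteratedFDeriv ℝ (N + 1 - (m + 1)) f) y‖ ≤ C * ‖x‖ ^ m := fun y hy => by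
        rw [norm_fderiv_iteratedFDeriv, ← hj]
        refine (ih (by omega) y).trans ?_
        rw [mem_closedBall_zero_iff] at hy
        gcongr
      have hd : Differentiable ℝ (iteratedFDeriv ℝ (N + 1 - (m + 1)) f) :=
        hf.differentiable_iteratedFDeriv (WithTop.coe_lt_coe.2 (ENat.natCast_lt_top _))
      have := (convex_closedBall (0 : Plane) ‖x‖).norm_image_sub_le_of_norm_fderiv_le
        (fun y _ => hd y) hb (x := 0) (y := x) (by simp) (by simp)
      rw [h0 _ (by omega), sub_zero, sub_zero] at this
      rwa [pow_succ, ← mul_assoc]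
  refine ⟨C, hC0, fun j hj x => ?_⟩
  have := key (N + 1 - j) (by omega) x
  rwa [show N + 1 - (N + 1 - j) = j by omega] at this

/-- A distribution that vanishes off the origin depends only on the germ of the test function. -/
lemma apply_eq_of_eventuallyEq {Ω : Opens Plane} {T : 𝓓'(Ω, ℝ)}
    (hT : restriction (puncture Ω) T = 0) {φ ψ : 𝓓(Ω, ℝ)} (h : φ =ᶠ[𝓝 0] ψ) : T φ = T ψ := by
  have hs : tsupport (φ - ψ) ⊆ (puncture Ω : Set Plane) := by
    refine subset_inter (φ - ψ).tsupport_subset fun x hx hx0 => ?_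
    rw [mem_singleton_iff.1 hx0] at hx
    refine (notMem_tsupport_iff_eventuallyEq.2 ?_) hx
    filter_upwards [h] with y hy
    simp [hy]
  have h2 := DFunLike.congr_fun hT ⟨φ - ψ, (φ - ψ).contDiff, (φ - ψ).hasCompactSupport, hs⟩
  rw [restriction_apply (puncture_le Ω)] at h2
  have h3 : T (φ - ψ) = 0 := h2
  rwa [map_sub, sub_eq_zero] at h3

/-- A smooth cutoff function for the ball of radius one. -/
noncomputable def unitBump : ContDiffBump (0 : Plane) := ⟨1, 2, one_pos, one_lt_two⟩

lemma unitBump_smul_eventuallyEq (c : ℝ) : (fun x => unitBump (c • x)) =ᶠ[𝓝 0] fun _ => 1 := by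
  have h : Tendsto (fun x : Plane => c • x) (𝓝 0) (𝓝 0) := by
    simpa using (continuous_const_smul c).tendsto (0 : Plane)
  exact h.eventually unitBump.eventuallyEq_one

lemma contDiff_unitBump_smul (c : ℝ) : ContDiff ℝ ∞ fun x => unitBump (c • x) :=
  unitBump.contDiff.comp (contDiff_const_smul c)

lemma tsupport_unitBump_smul {ε : ℝ} (hε : 0 < ε) :
    tsupport (fun x => unitBump (ε⁻¹ • x)) ⊆ Metric.closedBall 0 (2 * ε) := by
  refine closure_minimal (fun x hx => ?_) Metric.isClosed_closedBall
  have h1 : ε⁻¹ • x ∈ Metric.ball (0 : Plane) 2 := by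
    have : ε⁻¹ • x ∈ Function.support unitBump := hx
    rwa [unitBump.support_eq] at this
  rw [mem_ball_zero_iff, norm_smul, norm_inv, Real.norm_of_nonneg hε.le, inv_mul_lt_iff₀ hε] at h1
  rw [mem_closedBall_zero_iff]
  linarith

lemma originBall_le_of_closedBall_subset {Ω : Opens Plane} {r : ℝ}
    (hr : Metric.closedBall (0 : Plane) r ⊆ Ω) : originBall r ≤ Ω :=
  fun _ hx => hr (Metric.ball_subset_closedBall hx)

/-- A distribution supported at the origin annihilates the test functions that vanish to
sufficiently high order at the origin. -/
theorem exists_order_apply_eq_zero {Ω : Opens Plane} {T : 𝓓'(Ω, ℝ)}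
    (hT : restriction (puncture Ω) T = 0) {r : ℝ} (hr : Metric.closedBall (0 : Plane) r ⊆ Ω) :
    ∃ N : ℕ, ∀ ψ : 𝓓(originBall r, ℝ), (∀ j ≤ N, iteratedFDeriv ℝ j ψ 0 = 0) →
      T (extend (originBall_le_of_closedBall_subset hr) ψ) = 0 := by
  obtain ⟨N, D, hD⟩ := exists_order T ⟨Metric.closedBall 0 r, isCompact_closedBall _ _⟩ hr
  refine ⟨N, fun ψ h0 => ?_⟩
  obtain ⟨C, hC0, hC⟩ := exists_bound_of_flat ψ.contDiff ψ.hasCompactSupport h0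
  obtain ⟨A, hA0, hA⟩ := exists_bound_iteratedFDeriv (f := unitBump) unitBump.contDiff
    unitBump.hasCompactSupport N
  -- `A` bounds the derivatives of the bump and `C` is the Taylor constant of `ψ`. The factor `2 ^
  -- (N + 1)` comes from the support radius `2 * ε` of the scaled bump, and `2 ^ N` from the sum of
  -- the binomial coefficients in the Leibniz rule.
  set B : ℝ := 2 ^ N * (A * C * 2 ^ (N + 1)) with hB
  have hB0 : 0 ≤ B := by positivity
  have hmain : ∀ ε : ℝ, 0 < ε → ε ≤ 1 →
      |T (extend (originBall_le_of_closedBall_subset hr) ψ)| ≤ D * (B * ε) := by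
    intro ε hε hε1
    have hts : tsupport (fun x => unitBump (ε⁻¹ • x) * ψ x) ⊆ tsupport ψ :=
      tsupport_mul_subset_right
    let φ : 𝓓(Ω, ℝ) := cutoff Ω _ (contDiff_unitBump_smul ε⁻¹) ψ
      ((hts.trans ψ.tsupport_subset).trans (originBall_le_of_closedBall_subset hr))
    have hφ : T (extend (originBall_le_of_closedBall_subset hr) ψ) = T φ := by
      refine apply_eq_of_eventuallyEq hT ?_
      filter_upwards [unitBump_smul_eventuallyEq ε⁻¹] with x hx
      simp [φ, hx]
    rw [hφ]
    refine hD φ ((hts.trans ψ.tsupport_subset).trans Metric.ball_subset_closedBall) _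
      (by positivity) fun i hi x => ?_
    by_cases hx : x ∈ tsupport φ
    · have hx2 : ‖x‖ ≤ 2 * ε := by
        rw [← mem_closedBall_zero_iff]
        exact tsupport_unitBump_smul hε (tsupport_mul_subset_left hx)
      refine (norm_iteratedFDeriv_mul_le (contDiff_unitBump_smul ε⁻¹) ψ.contDiff x
        (n := i) (by exact_mod_cast le_top)).trans ?_
      have hterm : ∀ j ∈ Finset.range (i + 1),
          (i.choose j : ℝ) * ‖iteratedFDeriv ℝ j (fun y => unitBump (ε⁻¹ • y)) x‖ *
            ‖iteratedFDeriv ℝ (i - j) ψ x‖ ≤ i.choose j * (A * C * 2 ^ (N + 1) * ε) := by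
        intro j hj
        have hji : j ≤ i := Nat.lt_succ_iff.1 (Finset.mem_range.1 hj)
        have h1 : ‖iteratedFDeriv ℝ j (fun y => unitBump (ε⁻¹ • y)) x‖ ≤ (ε⁻¹) ^ j * A := by
          rw [iteratedFDeriv_comp_smul unitBump.contDiff, norm_smul, norm_pow, norm_inv,
            Real.norm_of_nonneg hε.le]
          exact mul_le_mul_of_nonneg_left (hA j (hji.trans hi) _) (by positivity)
        -- As `i ≤ N`, the Taylor exponent `N + 1 - (i - j)` is at least `j + 1`. This absorbs the
        -- loss `ε⁻¹ ^ j` from the bump and leaves one factor `ε`.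
        have h2 : ‖iteratedFDeriv ℝ (i - j) ψ x‖ ≤ C * (2 ^ (N + 1) * (ε * ε ^ j)) := by
          refine (hC (i - j) (by omega) x).trans (mul_le_mul_of_nonneg_left ?_ hC0)
          calc ‖x‖ ^ (N + 1 - (i - j)) ≤ (2 * ε) ^ (N + 1 - (i - j)) := by gcongr
            _ = 2 ^ (N + 1 - (i - j)) * ε ^ (N + 1 - (i - j)) := mul_pow _ _ _
            _ ≤ 2 ^ (N + 1) * (ε * ε ^ j) := by
              rw [← pow_succ']
              gcongr ?_ * ?_
              · exact pow_le_pow_right₀ one_le_two (by omega)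
              · exact pow_le_pow_of_le_one hε.le hε1 (by omega)
        rw [mul_assoc]
        refine mul_le_mul_of_nonneg_left ?_ (Nat.cast_nonneg _)
        refine (mul_le_mul h1 h2 (norm_nonneg _) (by positivity)).trans (le_of_eq ?_)
        have h3 : ε⁻¹ ^ j * ε ^ j = 1 := by rw [← mul_pow, inv_mul_cancel₀ hε.ne', one_pow]
        linear_combination A * C * 2 ^ (N + 1) * ε * h3
      refine (Finset.sum_le_sum hterm).trans ?_
      rw [← Finset.sum_mul]
      have h3 : ∑ j ∈ Finset.range (i + 1), (i.choose j : ℝ) = 2 ^ i := by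
        exact_mod_cast Nat.sum_range_choose i
      rw [h3, hB, mul_assoc (2 ^ N : ℝ)]
      exact mul_le_mul_of_nonneg_right (pow_le_pow_right₀ one_le_two hi) (by positivity)
    · have : iteratedFDeriv ℝ i φ x = 0 := by
        by_contra hne
        exact hx (support_iteratedFDeriv_subset i hne)
      rw [this, norm_zero]
      positivity
  have hlim : Tendsto (fun ε : ℝ => D * (B * ε)) (𝓝[>] 0) (𝓝 0) := by
    have : Tendsto (fun ε : ℝ => D * (B * ε)) (𝓝 0) (𝓝 (D * (B * 0))) :=
      (continuous_const.mul (continuous_const.mul continuous_id)).tendsto 0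
    simpa using this.mono_left nhdsWithin_le_nhds
  have := ge_of_tendsto hlim (b := |T (extend (originBall_le_of_closedBall_subset hr) ψ)|) (by
    filter_upwards [Ioc_mem_nhdsGT (zero_lt_one (α := ℝ))] with ε hε
    exact hmain ε hε.1 hε.2)
  exact abs_nonpos_iff.1 this

/-! ### Scaling -/

lemma rescale_apply {r lam : ℝ} (h : 0 < lam ∧ lam ≤ 1) (φ : 𝓓(originBall r, ℝ)) (x : Plane) :
    rescale lam φ x = (lam ^ 2)⁻¹ * φ (lam⁻¹ • x) := by
  rw [rescale, dif_pos h]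
  rfl

lemma originBall_mono {r s : ℝ} (h : r ≤ s) : originBall r ≤ originBall s :=
  Metric.ball_subset_ball h

lemma eventually_scale : ∀ᶠ lam : ℝ in 𝓝[>] 0, 0 < lam ∧ lam ≤ 1 :=
  Ioc_mem_nhdsGT zero_lt_one

/-- Scaling to zero on a ball implies scaling to zero on every smaller ball. -/
lemma tendsto_rescale_mono {Ω : Opens Plane} {T : 𝓓'(Ω, ℝ)} {k r s : ℝ} (hrs : r ≤ s)
    (hs : originBall s ≤ Ω)
    (h : ∀ φ : 𝓓(originBall s, ℝ), Tendsto (fun lam : ℝ =>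
      lam ^ k * restriction (originBall s) T (rescale lam φ)) (𝓝[>] 0) (𝓝 0))
    (φ : 𝓓(originBall r, ℝ)) : Tendsto (fun lam : ℝ =>
      lam ^ k * restriction (originBall r) T (rescale lam φ)) (𝓝[>] 0) (𝓝 0) := by
  refine (h (extend (originBall_mono hrs) φ)).congr' ?_
  filter_upwards [eventually_scale] with lam hlam
  rw [restriction_apply hs, restriction_apply ((originBall_mono hrs).trans hs)]
  congr 2
  ext x
  simp [rescale_apply hlam]

/-- A distribution supported at the origin that scales to zero with exponent `k ≤ 2 + d`
annihilates the test functions whose derivatives of order less than `d` vanish at the origin. -/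
theorem ScalesToZero.apply_eq_zero {Ω : Opens Plane} {T : 𝓓'(Ω, ℝ)}
    (hT : restriction (puncture Ω) T = 0) {k : ℝ} (hk : ScalesToZero T k) {d : ℕ}
    (hd : k ≤ 2 + d) (ψ : 𝓓(Ω, ℝ)) (hψ : ∀ j < d, iteratedFDeriv ℝ j ψ 0 = 0) : T ψ = 0 := by
  obtain ⟨s, hs, hsΩ, hsk⟩ := hk
  -- Halving the radius puts the closed ball inside `Ω`; the finite order bound needs a compact set.
  set r := s / 2 with hrs
  have hr : 0 < r := half_pos hs
  have hcl : Metric.closedBall (0 : Plane) r ⊆ Ω :=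
    (Metric.closedBall_subset_ball (half_lt_self hs)).trans hsΩ
  have hrΩ : originBall r ≤ Ω := originBall_le_of_closedBall_subset hcl
  have hrk := tendsto_rescale_mono (half_le_self hs.le) hsΩ hsk
  obtain ⟨N, hN⟩ := exists_order_apply_eq_zero hT hcl
  -- Descending induction on the vanishing order `d`, with `n` counting the steps: for `d ≥ N + 1`
  -- finite order already gives the result, and each step lowers `d` by one.
  have claim : ∀ n d : ℕ, N + 1 ≤ d + n → k ≤ 2 + d → ∀ φ : 𝓓(originBall r, ℝ),
      (∀ j < d, iteratedFDeriv ℝ j φ 0 = 0) → T (extend hrΩ φ) = 0 := by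
    intro n
    induction n with
    | zero => exact fun d hd _ φ hφ => hN φ fun j hj => hφ j (by omega)
    | succ n ih =>
      intro d hd hkd φ hφ
      -- If `φ` vanishes to order `d`, then `lam ^ d * φ (x / lam)` has the same derivative of order
      -- `d` at the origin as `φ`. The difference vanishes to one order more, so the induction
      -- hypothesis makes `T φ` exactly homogeneous under rescaling.
      have hscale : ∀ lam : ℝ, 0 < lam ∧ lam ≤ 1 →
          lam ^ (2 + d) * T (extend hrΩ (rescale lam φ)) = T (extend hrΩ φ) := by
        intro lam hlam
        have h0 := ih (d + 1) (by omega) (by push_cast; linarith)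
          (lam ^ (2 + d) • rescale lam φ - φ) fun j hj => by
            have hfun : ⇑(lam ^ (2 + d) • rescale lam φ - φ) =
                (fun x => lam ^ d • φ (lam⁻¹ • x)) - φ := by
              ext x
              have : lam ≠ 0 := hlam.1.ne'
              simp only [FunLike.coe_sub, FunLike.coe_smul, Pi.sub_apply, Pi.smul_apply,
                rescale_apply hlam, smul_eq_mul, pow_add]
              field_simp
            have hc : ContDiff ℝ ∞ fun x => φ (lam⁻¹ • x) :=
              φ.contDiff.comp (contDiff_const_smul _)
            have hj' : (j : WithTop ℕ∞) ≤ ∞ := by exact_mod_cast le_top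
            rw [hfun, iteratedFDeriv_sub ((hc.const_smul _).of_le hj')
              (φ.contDiff.of_le hj'), Pi.sub_apply,
              iteratedFDeriv_const_smul_apply' (hc.of_le hj').contDiffAt,
              iteratedFDeriv_comp_smul φ.contDiff, smul_zero, smul_smul, sub_eq_zero]
            rcases Nat.lt_succ_iff_lt_or_eq.1 hj with hj | rfl
            · rw [hφ j hj, smul_zero]
            · rw [← mul_pow, mul_inv_cancel₀ hlam.1.ne', one_pow, one_smul]
        have h1 : extend hrΩ (lam ^ (2 + d) • rescale lam φ - φ) =
            lam ^ (2 + d) • extend hrΩ (rescale lam φ) - extend hrΩ φ := rfl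
        rw [h1, map_sub, map_smul, sub_eq_zero, smul_eq_mul] at h0
        exact h0
      -- Since `k ≤ 2 + d` and `lam ≤ 1`, homogeneity bounds `|T φ|` by the quantity that tends to
      -- zero.
      have hlim := (hrk φ).abs
      rw [abs_zero] at hlim
      refine abs_nonpos_iff.1 (ge_of_tendsto hlim ?_)
      filter_upwards [eventually_scale] with lam hlam
      rw [restriction_apply hrΩ, abs_mul, ← hscale lam hlam, abs_mul]
      refine mul_le_mul_of_nonneg_right ?_ (abs_nonneg _)
      rw [abs_of_nonneg (by have := hlam.1; positivity),
        abs_of_nonneg (Real.rpow_nonneg hlam.1.le _), ← Real.rpow_natCast]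
      exact Real.rpow_le_rpow_of_exponent_ge hlam.1 hlam.2 (by push_cast; exact hkd)
  -- The bump scaled by `r / 4` is supported in the closed ball of radius `r / 2`, hence inside the
  -- open ball of radius `r`.
  have hr4 : 0 < r / 4 := by positivity
  let φ : 𝓓(originBall r, ℝ) := cutoff (originBall r) _ (contDiff_unitBump_smul (r / 4)⁻¹) ψ (by
    refine (tsupport_mul_subset_left).trans ((tsupport_unitBump_smul hr4).trans ?_)
    exact Metric.closedBall_subset_ball (by linarith))
  have hφψ : ψ =ᶠ[𝓝 0] φ := by
    filter_upwards [unitBump_smul_eventuallyEq (r / 4)⁻¹] with x hx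
    simp only [φ, cutoff_apply, hx, one_mul]
  rw [apply_eq_of_eventuallyEq hT (ψ := extend hrΩ φ) hφψ]
  refine claim (N + 1) d (by omega) hd φ fun j hj => ?_
  rw [← (hφψ.iteratedFDeriv ℝ j).eq_of_nhds]
  exact hψ j hj

/-! ### Derivatives of distributions and of their densities -/

lemma lineDeriv_testFunction_apply {U : Opens Plane} (i : Fin 2) (ψ : 𝓓(U, ℝ)) (x : Plane) :
    (∂_{basisVec i} ψ : 𝓓(U, ℝ)) x = partialDeriv i ψ x := by
  rw [TestFunction.lineDerivOp_eq_lineDerivCLM ℝ, TestFunction.lineDerivCLM_eq_fderivCLM,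
    TestFunction.fderivCLM_apply_of_le _ (by simp)]
  rfl

lemma lineDeriv_distribution_apply {U : Opens Plane} (i : Fin 2) (T : 𝓓'(U, ℝ)) (ψ : 𝓓(U, ℝ)) :
    (∂_{basisVec i} T : 𝓓'(U, ℝ)) ψ = -T (∂_{basisVec i} ψ) := by
  rw [Distribution.lineDerivOp_apply_apply, map_neg]

lemma extend_lineDeriv {W Ω : Opens Plane} (h : W ≤ Ω) (i : Fin 2) (ψ : 𝓓(W, ℝ)) :
    extend h (∂_{basisVec i} ψ) = ∂_{basisVec i} (extend h ψ) := by
  ext x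
  rw [extend_apply, lineDeriv_testFunction_apply, lineDeriv_testFunction_apply]
  rfl

lemma restriction_lineDeriv {W Ω : Opens Plane} (h : W ≤ Ω) (i : Fin 2) (T : 𝓓'(Ω, ℝ)) :
    restriction W (∂_{basisVec i} T) = ∂_{basisVec i} (restriction W T) := by
  ext ψ
  rw [restriction_apply h, lineDeriv_distribution_apply, lineDeriv_distribution_apply,
    restriction_apply h, extend_lineDeriv]

lemma restriction_sub {W Ω : Opens Plane} (S T : 𝓓'(Ω, ℝ)) :
    restriction W (S - T) = restriction W S - restriction W T :=
  map_sub _ _ _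

lemma IsSmoothDensity.sub {U : Opens Plane} {S T : 𝓓'(U, ℝ)} {f g : Plane → ℝ}
    (hf : IsSmoothDensity S f) (hg : IsSmoothDensity T g) :
    IsSmoothDensity (S - T) (fun x => f x - g x) := by
  refine ⟨hf.1.sub hg.1, fun ψ => ?_⟩
  have h : (S - T) ψ = S ψ - T ψ := rfl
  rw [h, hf.2, hg.2, setIntegral_mul_testFunction, setIntegral_mul_testFunction,
    setIntegral_mul_testFunction, ← integral_sub (integrable_mul_testFunction hf.1.continuousOn ψ)
    (integrable_mul_testFunction hg.1.continuousOn ψ)]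
  simp_rw [sub_mul]

lemma contDiffOn_partialDeriv {U : Set Plane} (hU : IsOpen U) {f : Plane → ℝ}
    (hf : ContDiffOn ℝ ∞ f U) (i : Fin 2) : ContDiffOn ℝ ∞ (partialDeriv i f) U :=
  (hf.fderiv_of_isOpen hU (by simp)).clm_apply contDiffOn_const

/-- Integration by parts: the test function has compact support in `U`, so there is no boundary
term, and `f` has to be differentiable only on that support. -/
lemma IsSmoothDensity.lineDeriv {U : Opens Plane} {T : 𝓓'(U, ℝ)} {f : Plane → ℝ}
    (h : IsSmoothDensity T f) (i : Fin 2) :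
    IsSmoothDensity (∂_{basisVec i} T) (partialDeriv i f) := by
  have hd := contDiffOn_partialDeriv U.isOpen h.1 i
  refine ⟨hd, fun ψ => ?_⟩
  rw [lineDeriv_distribution_apply, h.2, setIntegral_mul_testFunction,
    setIntegral_mul_testFunction]
  have hψ : ∀ x, (∂_{basisVec i} ψ : 𝓓(U, ℝ)) x = fderiv ℝ ψ x (basisVec i) :=
    lineDeriv_testFunction_apply i ψ
  have h1 := integrable_mul_testFunction h.1.continuousOn (∂_{basisVec i} ψ)
  simp_rw [hψ] at h1 ⊢
  rw [integral_mul_fderiv_eq_neg_fderiv_mul_of_integrable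
    (integrable_mul_testFunction hd.continuousOn ψ) h1
    (integrable_mul_testFunction h.1.continuousOn ψ), neg_neg]
  · rfl
  · intro x hx
    exact (h.1.contDiffAt (U.isOpen.mem_nhds (ψ.tsupport_subset hx))).differentiableAt (by simp)
  · intro x _
    exact ψ.contDiff.differentiable (by simp) x

lemma isSmoothDensity_curl {Ω U : Opens Plane} (hU : U ≤ Ω) {v : VectorDistribution Ω}
    {f : Plane → Fin 2 → ℝ} (h : ∀ i, IsSmoothDensity (restriction U (v i)) (fun x => f x i)) :
    IsSmoothDensity (restriction U (distCurl v)) (curl f) := by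
  rw [distCurl, restriction_sub, restriction_lineDeriv hU, restriction_lineDeriv hU]
  exact ((h 1).lineDeriv 0).sub ((h 0).lineDeriv 1)

lemma IsRegularPart.density_curlTensor {Ω : Opens Plane} {E : TensorDistribution Ω}
    {E₀ : Plane → Matrix (Fin 2) (Fin 2) ℝ} (h : IsRegularPart E E₀) (i : Fin 2) :
    IsSmoothDensity (restriction (puncture Ω) (distCurlTensor E i))
      (fun x => curlTensor E₀ x i) :=
  isSmoothDensity_curl (puncture_le Ω) fun j => h i j

lemma IsRegularPart.density_curlCurl {Ω : Opens Plane} {E : TensorDistribution Ω}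
    {E₀ : Plane → Matrix (Fin 2) (Fin 2) ℝ} (h : IsRegularPart E E₀) :
    IsSmoothDensity (restriction (puncture Ω) (distCurlCurl E)) (curlCurl E₀) :=
  isSmoothDensity_curl (puncture_le Ω) h.density_curlTensor

/-- Compatibility of the regular part means that `Curl Curl E` is supported at the origin. -/
theorem IsRegularPart.isCurlCurlFree_iff {Ω : Opens Plane} {E : TensorDistribution Ω}
    {E₀ : Plane → Matrix (Fin 2) (Fin 2) ℝ} (h : IsRegularPart E E₀) :
    IsCurlCurlFree Ω E₀ ↔ restriction (puncture Ω) (distCurlCurl E) = 0 := by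
  constructor
  · intro hc
    ext ψ
    rw [h.density_curlCurl.2, setIntegral_congr_fun (g := fun _ => (0 : ℝ)) (puncture Ω).isOpen.measurableSet
      fun x hx => by simp [hc x hx]]
    simp
  · intro hT x hx
    refine eq_zero_of_integral_testFunction h.density_curlCurl.1.continuousOn (fun ψ => ?_) hx
    rw [← h.density_curlCurl.2, hT]
    rfl

/-! ### Scaling of derivatives -/

lemma partialDeriv_testFunction_comp_smul {r : ℝ} (φ : 𝓓(originBall r, ℝ)) (i : Fin 2) (a c : ℝ)
    (x : Plane) :
    partialDeriv i (fun y => a * φ (c • y)) x = a * (c * partialDeriv i φ (c • x)) := by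
  have h1 : HasFDerivAt φ (fderiv ℝ φ (c • x)) (c • x) :=
    (φ.contDiff.differentiable (by simp) _).hasFDerivAt
  have h2 : HasFDerivAt (fun y : Plane => c • y) (c • ContinuousLinearMap.id ℝ Plane) x :=
    (hasFDerivAt_id x).const_smul c
  have h3 := (h1.comp x h2).const_mul a
  rw [partialDeriv, show (fun y => a * φ (c • y)) = fun y => a * (φ ∘ fun y => c • y) y from rfl,
    h3.fderiv]
  simp [partialDeriv]

/-- Each derivative costs one factor `lam⁻¹`; applied twice, this raises the scaling exponent of
`Curl Curl E` by two. -/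
lemma lineDeriv_rescale {r lam : ℝ} (h : 0 < lam ∧ lam ≤ 1) (i : Fin 2) (φ : 𝓓(originBall r, ℝ)) :
    ∂_{basisVec i} (rescale lam φ) = lam⁻¹ • rescale lam (∂_{basisVec i} φ) := by
  ext x
  have hf : ⇑(rescale lam φ) = fun x => (lam ^ 2)⁻¹ * φ (lam⁻¹ • x) := funext (rescale_apply h φ)
  rw [lineDeriv_testFunction_apply, hf, partialDeriv_testFunction_comp_smul, FunLike.coe_smul,
    Pi.smul_apply, rescale_apply h, lineDeriv_testFunction_apply, smul_eq_mul]
  ring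

lemma distCurlCurl_apply {Ω : Opens Plane} (E : TensorDistribution Ω) (ψ : 𝓓(Ω, ℝ)) :
    distCurlCurl E ψ =
      (E 1 1 (∂_{basisVec 0} (∂_{basisVec 0} ψ)) - E 1 0 (∂_{basisVec 1} (∂_{basisVec 0} ψ))) -
      (E 0 1 (∂_{basisVec 0} (∂_{basisVec 1} ψ)) - E 0 0 (∂_{basisVec 1} (∂_{basisVec 1} ψ))) := by
  have h : ∀ (S T : 𝓓'(Ω, ℝ)) (φ : 𝓓(Ω, ℝ)), (S - T) φ = S φ - T φ := fun _ _ _ => rfl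
  simp only [distCurlCurl, distCurlTensor, distCurl, h, lineDeriv_distribution_apply]
  ring

/-- If `E` scales to zero with exponent `k`, then `Curl Curl E` does with exponent `k + 2`. -/
theorem scalesToZero_distCurlCurl {Ω : Opens Plane} {E : TensorDistribution Ω} {k : ℝ}
    (h : ∀ i j, ScalesToZero (E i j) k) : ScalesToZero (distCurlCurl E) (k + 2) := by
  choose r hr hrΩ hlim using h
  -- The four components may come with different balls; all of them scale on the smallest one.
  obtain ⟨s, hs, hsr⟩ : ∃ s, 0 < s ∧ ∀ i j, s ≤ r i j := by
    refine ⟨min (min (r 0 0) (r 0 1)) (min (r 1 0) (r 1 1)), by simp [hr], fun i j => ?_⟩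
    fin_cases i <;> fin_cases j <;> simp
  have hsΩ : originBall s ≤ Ω := (originBall_mono (hsr 0 0)).trans (hrΩ 0 0)
  have hE : ∀ (i j : Fin 2) (φ : 𝓓(originBall s, ℝ)), Tendsto (fun lam : ℝ =>
      lam ^ k * E i j (extend hsΩ (rescale lam φ))) (𝓝[>] 0) (𝓝 0) := fun i j φ => by
    have := tendsto_rescale_mono (hsr i j) (hrΩ i j) (hlim i j) φ
    simpa only [restriction_apply hsΩ] using this
  refine ⟨s, hs, hsΩ, fun φ => ?_⟩
  have hsum := ((hE 1 1 (∂_{basisVec 0} (∂_{basisVec 0} φ))).sub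
    (hE 1 0 (∂_{basisVec 1} (∂_{basisVec 0} φ)))).sub
    ((hE 0 1 (∂_{basisVec 0} (∂_{basisVec 1} φ))).sub
    (hE 0 0 (∂_{basisVec 1} (∂_{basisVec 1} φ))))
  simp only [sub_zero] at hsum
  refine hsum.congr' ?_
  filter_upwards [eventually_scale] with lam hlam
  have hdd : ∀ i j : Fin 2, ∂_{basisVec i} (∂_{basisVec j} (extend hsΩ (rescale lam φ))) =
      (lam⁻¹ * lam⁻¹) • extend hsΩ (rescale lam (∂_{basisVec i} (∂_{basisVec j} φ))) := by
    intro i j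
    rw [← extend_lineDeriv, ← extend_lineDeriv, lineDeriv_rescale hlam,
      show ∂_{basisVec i} (lam⁻¹ • rescale lam (∂_{basisVec j} φ)) =
        lam⁻¹ • ∂_{basisVec i} (rescale lam (∂_{basisVec j} φ)) from
        LineDeriv.lineDerivOp_smul _ _ _, lineDeriv_rescale hlam, smul_smul]
    rfl
  rw [restriction_apply hsΩ, distCurlCurl_apply]
  simp only [hdd, map_smul, smul_eq_mul]
  rw [Real.rpow_add hlam.1, Real.rpow_two]
  have : lam ≠ 0 := hlam.1.ne'
  field_simp

/-! ### Stokes' theorem on an annulus -/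

lemma circlePoint_eq (r θ : ℝ) :
    circlePoint r θ = (r * Real.cos θ) • basisVec 0 + (r * Real.sin θ) • basisVec 1 := by
  ext i
  fin_cases i <;> simp [circlePoint, basisVec]

lemma norm_circlePoint {r : ℝ} (hr : 0 ≤ r) (θ : ℝ) : ‖circlePoint r θ‖ = r := by
  rw [← sq_eq_sq₀ (norm_nonneg _) hr, EuclideanSpace.norm_sq_eq, Fin.sum_univ_two]
  simp only [circlePoint, Real.norm_eq_abs, sq_abs, Matrix.cons_val_zero, Matrix.cons_val_one,
    Matrix.cons_val_fin_one]
  linear_combination r ^ 2 * Real.sin_sq_add_cos_sq θ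

lemma continuous_circlePoint : Continuous fun p : ℝ × ℝ => circlePoint p.1 p.2 := by
  simp_rw [circlePoint_eq]
  fun_prop

lemma differentiable_circlePoint : Differentiable ℝ fun p : ℝ × ℝ => circlePoint p.1 p.2 := by
  simp_rw [circlePoint_eq]
  fun_prop

lemma hasDerivAt_comp_circlePoint_radius {f : Plane → ℝ} {r θ : ℝ}
    (hf : DifferentiableAt ℝ f (circlePoint r θ)) :
    HasDerivAt (fun s => f (circlePoint s θ))
      (Real.cos θ * partialDeriv 0 f (circlePoint r θ) +
        Real.sin θ * partialDeriv 1 f (circlePoint r θ)) r := by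
  have h : HasDerivAt (fun s => circlePoint s θ)
      (Real.cos θ • basisVec 0 + Real.sin θ • basisVec 1) r := by
    simp_rw [circlePoint_eq]
    refine ((((hasDerivAt_id r).mul_const (Real.cos θ)).smul_const (basisVec 0)).add
      (((hasDerivAt_id r).mul_const (Real.sin θ)).smul_const (basisVec 1))).congr_deriv ?_
    simp
  refine (hf.hasFDerivAt.comp_hasDerivAt r h).congr_deriv ?_
  simp [partialDeriv]

lemma hasDerivAt_comp_circlePoint_angle {f : Plane → ℝ} {r θ : ℝ}
    (hf : DifferentiableAt ℝ f (circlePoint r θ)) :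
    HasDerivAt (fun t => f (circlePoint r t))
      (-(r * Real.sin θ) * partialDeriv 0 f (circlePoint r θ) +
        r * Real.cos θ * partialDeriv 1 f (circlePoint r θ)) θ := by
  have h : HasDerivAt (fun t => circlePoint r t)
      ((-(r * Real.sin θ)) • basisVec 0 + (r * Real.cos θ) • basisVec 1) θ := by
    simp_rw [circlePoint_eq]
    refine ((((Real.hasDerivAt_cos θ).const_mul r).smul_const (basisVec 0)).add
      (((Real.hasDerivAt_sin θ).const_mul r).smul_const (basisVec 1))).congr_deriv ?_
    simp
  refine (hf.hasFDerivAt.comp_hasDerivAt θ h).congr_deriv ?_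
  simp [partialDeriv]

/-- The integral of the one-form `w₀ dy₁ + w₁ dy₂` over the circle of radius `r`. -/
noncomputable def loopIntegral (w : Plane → Fin 2 → ℝ) (r : ℝ) : ℝ :=
  ∫ θ in (0 : ℝ)..(2 * Real.pi), (w (circlePoint r θ) 0 * -(r * Real.sin θ) +
    w (circlePoint r θ) 1 * (r * Real.cos θ))

/-- Green's theorem on an annulus, in polar coordinates. -/
theorem integral_curl_polar {V : Set Plane} (hV : IsOpen V) {w : Plane → Fin 2 → ℝ}
    (hw : ∀ i, ContDiffOn ℝ ∞ (fun x => w x i) V) {r₁ r₂ : ℝ} (h12 : r₁ ≤ r₂)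
    (hmem : ∀ r ∈ Icc r₁ r₂, ∀ θ, circlePoint r θ ∈ V) :
    ∫ r in r₁..r₂, ∫ θ in (0 : ℝ)..(2 * Real.pi), r * curl w (circlePoint r θ) =
      loopIntegral w r₂ - loopIntegral w r₁ := by
  -- Pulled back to polar coordinates, the form has `dθ`-coefficient `f` and `dr`-coefficient `-g`.
  -- Its exterior derivative is therefore the divergence of `(f, g)`, which equals `r * curl w`.
  let f : ℝ × ℝ → ℝ := fun p => w (circlePoint p.1 p.2) 0 * -(p.1 * Real.sin p.2) +
    w (circlePoint p.1 p.2) 1 * (p.1 * Real.cos p.2)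
  let g : ℝ × ℝ → ℝ := fun p => -(w (circlePoint p.1 p.2) 0 * Real.cos p.2 +
    w (circlePoint p.1 p.2) 1 * Real.sin p.2)
  have hd : ∀ i, ∀ x ∈ V, DifferentiableAt ℝ (fun x => w x i) x := fun i x hx =>
    ((hw i).contDiffAt (hV.mem_nhds hx)).differentiableAt (by simp)
  have hdc : ∀ i (p : ℝ × ℝ), p.1 ∈ Icc r₁ r₂ →
      DifferentiableAt ℝ (fun p : ℝ × ℝ => w (circlePoint p.1 p.2) i) p := fun i p hp =>
    DifferentiableAt.comp (g := fun x => w x i) p (hd i _ (hmem p.1 hp p.2))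
      (differentiable_circlePoint p)
  have hf : ∀ p : ℝ × ℝ, p.1 ∈ Icc r₁ r₂ → DifferentiableAt ℝ f p := fun p hp => by
    exact ((hdc 0 p hp).mul (by fun_prop)).add ((hdc 1 p hp).mul (by fun_prop))
  have hg : ∀ p : ℝ × ℝ, p.1 ∈ Icc r₁ r₂ → DifferentiableAt ℝ g p := fun p hp => by
    exact (((hdc 0 p hp).mul (by fun_prop)).add ((hdc 1 p hp).mul (by fun_prop))).neg
  have hdiv : ∀ p : ℝ × ℝ, p.1 ∈ Icc r₁ r₂ →
      fderiv ℝ f p (1, 0) + fderiv ℝ g p (0, 1) = p.1 * curl w (circlePoint p.1 p.2) := by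
    rintro ⟨r, θ⟩ hp
    have hx := hmem r hp θ
    have hf1 : HasDerivAt (fun s => f (s, θ)) (fderiv ℝ f (r, θ) (1, 0)) r :=
      HasFDerivAt.comp_hasDerivAt (f := fun s : ℝ => (s, θ)) r (hf (r, θ) hp).hasFDerivAt
        ((hasDerivAt_id r).prodMk (hasDerivAt_const r θ))
    have hg1 : HasDerivAt (fun t => g (r, t)) (fderiv ℝ g (r, θ) (0, 1)) θ :=
      HasFDerivAt.comp_hasDerivAt (f := fun t : ℝ => (r, t)) θ (hg (r, θ) hp).hasFDerivAt
        ((hasDerivAt_const θ r).prodMk (hasDerivAt_id θ))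
    have hf2 := ((hasDerivAt_comp_circlePoint_radius (hd 0 _ hx)).mul
      ((hasDerivAt_id r).mul_const (Real.sin θ)).neg).add
      ((hasDerivAt_comp_circlePoint_radius (hd 1 _ hx)).mul
      ((hasDerivAt_id r).mul_const (Real.cos θ)))
    have hg2 := (((hasDerivAt_comp_circlePoint_angle (hd 0 _ hx)).mul
      (Real.hasDerivAt_cos θ)).add
      ((hasDerivAt_comp_circlePoint_angle (hd 1 _ hx)).mul (Real.hasDerivAt_sin θ))).neg
    rw [hf1.unique hf2, hg1.unique hg2, curl]
    simp only [id, Pi.neg_apply]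
    linear_combination (r * (partialDeriv 0 (fun y => w y 1) (circlePoint r θ) -
      partialDeriv 1 (fun y => w y 0) (circlePoint r θ))) * Real.sin_sq_add_cos_sq θ
  have hcurl : ContinuousOn (curl w) V :=
    ((contDiffOn_partialDeriv hV (hw 1) 0).sub (contDiffOn_partialDeriv hV (hw 0) 1)).continuousOn
  have hIcc : ∀ p ∈ uIcc r₁ r₂ ×ˢ uIcc 0 (2 * Real.pi), p.1 ∈ Icc r₁ r₂ := fun p hp => by
    rw [← uIcc_of_le h12]; exact hp.1
  have hIoo : ∀ p ∈ Ioo (min r₁ r₂) (max r₁ r₂) ×ˢ Ioo (min 0 (2 * Real.pi)) (max 0 (2 * Real.pi)),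
      p.1 ∈ Icc r₁ r₂ := fun p hp => by
    have := hp.1
    rw [min_eq_left h12, max_eq_right h12] at this
    exact Ioo_subset_Icc_self this
  have hcont : ContinuousOn (fun p : ℝ × ℝ => p.1 * curl w (circlePoint p.1 p.2))
      (uIcc r₁ r₂ ×ˢ uIcc 0 (2 * Real.pi)) :=
    continuous_fst.continuousOn.mul (hcurl.comp continuous_circlePoint.continuousOn
      fun p hp => hmem p.1 (hIcc p hp) p.2)
  have key := integral2_divergence_prod_of_hasFDerivAt f g (fderiv ℝ f) (fderiv ℝ g) r₁ 0 r₂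
    (2 * Real.pi) (fun p hp => (hf p (hIcc p hp)).continuousAt.continuousWithinAt)
    (fun p hp => (hg p (hIcc p hp)).continuousAt.continuousWithinAt)
    (fun p hp => (hf p (hIoo p hp)).hasFDerivAt) (fun p hp => (hg p (hIoo p hp)).hasFDerivAt)
    ((hcont.integrableOn_compact (isCompact_uIcc.prod isCompact_uIcc)).congr_fun
      (fun p hp => (hdiv p (hIcc p hp)).symm) (measurableSet_uIcc.prod measurableSet_uIcc))
  -- The sides `θ = 0` and `θ = 2π` of the rectangle cancel by periodicity, leaving the two circles.
  have hper : ∀ r, g (r, 2 * Real.pi) = g (r, 0) := fun r => by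
    simp [g, circlePoint]
  simp_rw [hper, sub_self, zero_add] at key
  rw [show loopIntegral w r₂ - loopIntegral w r₁ = _ from key.symm]
  refine intervalIntegral.integral_congr fun r hr => ?_
  refine intervalIntegral.integral_congr fun θ _ => ?_
  rw [uIcc_of_le h12] at hr
  exact (hdiv (r, θ) hr).symm

/-- Integration in polar coordinates over an annulus. -/
theorem integral_eq_integral_polar {F : Plane → ℝ} {r₁ r₂ : ℝ} (h1 : 0 < r₁) (h12 : r₁ ≤ r₂)
    (hF : ContinuousOn F {x | r₁ ≤ ‖x‖ ∧ ‖x‖ ≤ r₂}) (hin : ∀ x, x ≠ 0 → ‖x‖ < r₁ → F x = 0)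
    (hout : ∀ x, r₂ < ‖x‖ → F x = 0) :
    ∫ x, F x = ∫ r in r₁..r₂, ∫ θ in (0 : ℝ)..(2 * Real.pi), r * F (circlePoint r θ) := by
  have hmp : MeasurePreserving (fun p : ℝ × ℝ => (!₂[p.1, p.2] : Plane)) :=
    (EuclideanSpace.volume_preserving_symm_measurableEquiv_toLp (Fin 2)).symm.comp
      (volume_preserving_finTwoArrow ℝ).symm
  have hme : MeasurableEmbedding (fun p : ℝ × ℝ => (!₂[p.1, p.2] : Plane)) :=
    ((MeasurableEquiv.finTwoArrow (α := ℝ)).symm.trans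
      (MeasurableEquiv.toLp 2 (Fin 2 → ℝ))).measurableEmbedding
  rw [← hmp.integral_comp hme, ← integral_comp_polarCoord_symm]
  have hG : ContinuousOn (fun p : ℝ × ℝ => p.1 * F (circlePoint p.1 p.2))
      (Icc r₁ r₂ ×ˢ Icc (-Real.pi) Real.pi) :=
    continuous_fst.continuousOn.mul (hF.comp continuous_circlePoint.continuousOn fun p hp => by
      have := norm_circlePoint (h1.le.trans hp.1.1) p.2
      exact ⟨hp.1.1.trans_eq this.symm, this.trans_le hp.1.2⟩)
  -- The integrand vanishes outside the annulus, so the polar domain shrinks to a bounded rectangle;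
  -- half-open and open sides differ by null sets.
  have hstep : ∫ p in polarCoord.target, p.1 • F !₂[(polarCoord.symm p).1, (polarCoord.symm p).2] =
      ∫ p in Ioc r₁ r₂ ×ˢ Ioc (-Real.pi) Real.pi, p.1 * F (circlePoint p.1 p.2) := by
    have hsub : Icc r₁ r₂ ×ˢ Ioo (-Real.pi) Real.pi ⊆ polarCoord.target := by
      rintro p ⟨hp1, hp2⟩
      exact ⟨h1.trans_le hp1.1, hp2⟩
    have h3 : ∀ p ∈ polarCoord.target \ (Icc r₁ r₂ ×ˢ Ioo (-Real.pi) Real.pi),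
        p.1 * F (circlePoint p.1 p.2) = 0 := by
      rintro p ⟨⟨hp1, hp2⟩, hn⟩
      have hp1 : 0 < p.1 := hp1
      have hnorm := norm_circlePoint hp1.le p.2
      rcases lt_or_ge p.1 r₁ with hlt | hge
      · rw [hin _ (by rw [← norm_pos_iff, hnorm]; exact hp1) (by rwa [hnorm]), mul_zero]
      · rcases lt_or_ge r₂ p.1 with hlt | hge'
        · rw [hout _ (by rwa [hnorm]), mul_zero]
        · exact absurd ⟨⟨hge, hge'⟩, hp2⟩ hn
    have h4 : ∀ p : ℝ × ℝ, p.1 • F !₂[(polarCoord.symm p).1, (polarCoord.symm p).2] =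
        p.1 * F (circlePoint p.1 p.2) := fun p => rfl
    simp_rw [h4]
    rw [setIntegral_eq_of_subset_of_forall_sdiff_eq_zero polarCoord.open_target.measurableSet hsub h3]
    exact setIntegral_congr_set (Measure.set_prod_ae_eq Ioc_ae_eq_Icc.symm Ioo_ae_eq_Ioc)
  rw [hstep]
  have hint : IntegrableOn (fun p : ℝ × ℝ => p.1 * F (circlePoint p.1 p.2))
      (Ioc r₁ r₂ ×ˢ Ioc (-Real.pi) Real.pi) (volume.prod volume) :=
    (hG.integrableOn_compact (isCompact_Icc.prod isCompact_Icc)).mono_set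
      (prod_mono Ioc_subset_Icc_self Ioc_subset_Icc_self)
  rw [Measure.volume_eq_prod, setIntegral_prod _ hint, intervalIntegral.integral_of_le h12]
  congr 1
  ext r
  rw [← intervalIntegral.integral_of_le (by linarith [Real.pi_pos])]
  -- `polarCoord` uses angles in `(-π, π)`; periodicity moves the integral to `[0, 2π]`.
  have hper : Function.Periodic (fun θ => r * F (circlePoint r θ)) (2 * Real.pi) := fun θ => by
    simp [circlePoint]
  have := hper.intervalIntegral_add_eq (-Real.pi) 0
  rw [zero_add, show -Real.pi + 2 * Real.pi = Real.pi by ring] at this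
  exact this

/-! ### Cutoff functions -/

/-- `χ` is one near the closed ball of radius `ε` and zero near the complement of the open ball of
radius `R`. -/
structure IsCutoff {Ω : Opens Plane} (ε R : ℝ) (χ : 𝓓(Ω, ℝ)) : Prop where
  pos : 0 < ε
  lt : ε < R
  subset : Metric.closedBall (0 : Plane) R ⊆ Ω
  one : ∀ x : Plane, ‖x‖ ≤ ε → χ =ᶠ[𝓝 x] fun _ => 1
  zero : ∀ x : Plane, R ≤ ‖x‖ → χ =ᶠ[𝓝 x] fun _ => 0

lemma exists_isCutoff {Ω : Opens Plane} {ε : ℝ} (hε : 0 < ε)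
    (h : Metric.closedBall (0 : Plane) ε ⊆ Ω) : ∃ (R : ℝ) (χ : 𝓓(Ω, ℝ)), IsCutoff ε R χ := by
  obtain ⟨δ, hδ, hsub⟩ := (isCompact_closedBall (0 : Plane) ε).exists_cthickening_subset_open
    Ω.isOpen h
  rw [cthickening_closedBall hδ.le hε.le] at hsub
  -- The strict nesting `ε < ε + δ / 3 < ε + δ / 2 < ε + δ` makes the bump locally constant even at
  -- points of the circles of radii `ε` and `R = ε + δ`.
  let b : ContDiffBump (0 : Plane) := ⟨ε + δ / 3, ε + δ / 2, by positivity, by linarith⟩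
  have hb : tsupport b = Metric.closedBall 0 (ε + δ / 2) := b.tsupport_eq
  refine ⟨δ + ε, ⟨b, b.contDiff, b.hasCompactSupport, ?_⟩, hε, by linarith, by rwa [add_comm] at hsub ⊢,
    fun x hx => ?_, fun x hx => ?_⟩
  · rw [hb]
    exact (Metric.closedBall_subset_closedBall (by linarith)).trans hsub
  · refine b.eventuallyEq_one_of_mem_ball (mem_ball_zero_iff.2 ?_)
    change ‖x‖ < ε + δ / 3
    linarith
  · refine notMem_tsupport_iff_eventuallyEq.1 ?_
    change x ∉ tsupport b
    rw [hb, mem_closedBall_zero_iff]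
    linarith

lemma partialDeriv_eq_zero_of_eventuallyEq {f : Plane → ℝ} {x : Plane} {c : ℝ}
    (h : f =ᶠ[𝓝 x] fun _ => c) (i : Fin 2) : partialDeriv i f x = 0 := by
  rw [partialDeriv, h.fderiv_eq]
  simp

lemma mem_puncture_of_norm {Ω : Opens Plane} {R : ℝ} (h : Metric.closedBall (0 : Plane) R ⊆ Ω)
    {x : Plane} (h0 : 0 < ‖x‖) (hR : ‖x‖ ≤ R) : x ∈ puncture Ω :=
  ⟨h (mem_closedBall_zero_iff.2 hR), norm_pos_iff.1 h0⟩

lemma partialDeriv_mul {f g : Plane → ℝ} {x : Plane} (hf : DifferentiableAt ℝ f x)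
    (hg : DifferentiableAt ℝ g x) (i : Fin 2) :
    partialDeriv i (fun y => f y * g y) x = f x * partialDeriv i g x + partialDeriv i f x * g x := by
  rw [partialDeriv, fderiv_fun_mul hf hg]
  simp [partialDeriv, mul_comm]

lemma partialDeriv_add {f g : Plane → ℝ} {x : Plane} (hf : DifferentiableAt ℝ f x)
    (hg : DifferentiableAt ℝ g x) (i : Fin 2) :
    partialDeriv i (fun y => f y + g y) x = partialDeriv i f x + partialDeriv i g x := by
  rw [partialDeriv, fderiv_fun_add hf hg]
  rfl

/-- For closed `w` the integrand is the density of dχ ∧ w = d(χw), which vanishes outside the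
annulus between the radii `ε` and `R`. By Green's theorem only the circles contribute: χw is zero on
the outer one and equals `w` on the inner one, whose orientation gives the sign. -/
lemma IsCutoff.integral_wedge {Ω : Opens Plane} {ε R : ℝ} {χ : 𝓓(Ω, ℝ)} (hχ : IsCutoff ε R χ)
    {w : Plane → Fin 2 → ℝ} (hw : ∀ i, ContDiffOn ℝ ∞ (fun x => w x i) (puncture Ω))
    (hcurl : ∀ x ∈ puncture Ω, curl w x = 0) :
    ∫ x, (w x 1 * partialDeriv 0 χ x - w x 0 * partialDeriv 1 χ x) = -loopIntegral w ε := by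
  have hV := (puncture Ω).isOpen
  have hχd : ContDiff ℝ ∞ χ := χ.contDiff
  have hpd : ∀ i, Continuous (partialDeriv i χ) := fun i =>
    continuousOn_univ.1 (contDiffOn_partialDeriv isOpen_univ hχd.contDiffOn i).continuousOn
  have hcont : ContinuousOn (fun x => w x 1 * partialDeriv 0 χ x - w x 0 * partialDeriv 1 χ x)
      (puncture Ω) :=
    ((hw 1).continuousOn.mul (hpd 0).continuousOn).sub ((hw 0).continuousOn.mul (hpd 1).continuousOn)
  have hcircle : ∀ r ∈ Icc ε R, ∀ θ, circlePoint r θ ∈ puncture Ω := fun r hr θ => by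
    have h0 := hχ.pos.trans_le hr.1
    have hn := norm_circlePoint h0.le θ
    exact mem_puncture_of_norm hχ.subset (by rwa [hn]) (by rw [hn]; exact hr.2)
  rw [integral_eq_integral_polar hχ.pos hχ.lt.le (hcont.mono fun x hx =>
    mem_puncture_of_norm hχ.subset (hχ.pos.trans_le hx.1) hx.2)]
  · have hw' : ∀ i, ContDiffOn ℝ ∞ (fun x => (fun j => χ x * w x j) i) (puncture Ω) := fun i =>
      hχd.contDiffOn.mul (hw i)
    have hS := integral_curl_polar hV hw' hχ.lt.le hcircle
    have hR : loopIntegral (fun x j => χ x * w x j) R = 0 := by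
      have h0 : ∀ θ, χ (circlePoint R θ) = 0 := fun θ =>
        (hχ.zero _ (norm_circlePoint (hχ.pos.trans hχ.lt).le θ).ge).eq_of_nhds
      simp [loopIntegral, h0]
    have hε : loopIntegral (fun x j => χ x * w x j) ε = loopIntegral w ε := by
      have h0 : ∀ θ, χ (circlePoint ε θ) = 1 := fun θ =>
        (hχ.one _ (norm_circlePoint hχ.pos.le θ).le).eq_of_nhds
      simp [loopIntegral, h0]
    rw [hR, hε, zero_sub] at hS
    rw [← hS]
    refine intervalIntegral.integral_congr fun r hr => ?_
    refine intervalIntegral.integral_congr fun θ _ => ?_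
    rw [uIcc_of_le hχ.lt.le] at hr
    have hx := hcircle r hr θ
    have hd : ∀ i, DifferentiableAt ℝ (fun x => w x i) (circlePoint r θ) := fun i =>
      ((hw i).contDiffAt (hV.mem_nhds hx)).differentiableAt (by simp)
    have hdχ : DifferentiableAt ℝ χ (circlePoint r θ) := hχd.differentiable (by simp) _
    have hc := hcurl _ hx
    simp only [curl] at hc ⊢
    rw [partialDeriv_mul hdχ (hd 1), partialDeriv_mul hdχ (hd 0)]
    linear_combination -r * χ (circlePoint r θ) * hc
  · intro x _ hx
    have := fun i => partialDeriv_eq_zero_of_eventuallyEq (hχ.one x hx.le) i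
    simp [this]
  · intro x hx
    have := fun i => partialDeriv_eq_zero_of_eventuallyEq (hχ.zero x hx.le) i
    simp [this]

/-! ### Pairing with test functions that vanish near the origin -/

/-- A test function that vanishes near the origin, as a test function on the punctured set. -/
noncomputable def toPuncture {Ω : Opens Plane} (ψ : 𝓓(Ω, ℝ)) (h : ψ =ᶠ[𝓝 0] fun _ => 0) :
    𝓓(puncture Ω, ℝ) :=
  ⟨ψ, ψ.contDiff, ψ.hasCompactSupport, subset_inter ψ.tsupport_subset fun x hx hx0 => by
    rw [mem_singleton_iff.1 hx0] at hx
    exact notMem_tsupport_iff_eventuallyEq.2 h hx⟩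

lemma integrable_of_eventuallyEq_zero {Ω : Opens Plane} {f : Plane → ℝ}
    (hf : ContinuousOn f (puncture Ω)) {ψ : 𝓓(Ω, ℝ)} (h : ψ =ᶠ[𝓝 0] fun _ => 0) :
    Integrable fun x => f x * ψ x :=
  integrable_mul_testFunction hf (toPuncture ψ h)

/-- This passes from distributions to E₀: the derivatives of a cutoff, and their products with
coordinates, vanish near the origin and so see only the regular part. -/
lemma apply_eq_integral {Ω : Opens Plane} {T : 𝓓'(Ω, ℝ)} {f : Plane → ℝ}
    (hf : IsSmoothDensity (restriction (puncture Ω) T) f) {ψ : 𝓓(Ω, ℝ)}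
    (h : ψ =ᶠ[𝓝 0] fun _ => 0) : T ψ = ∫ x, f x * ψ x := by
  have := hf.2 (toPuncture ψ h)
  rw [restriction_apply (puncture_le Ω), setIntegral_mul_testFunction] at this
  exact this

lemma contDiff_coord (i : Fin 2) : ContDiff ℝ ∞ fun x : Plane => x i := by
  fun_prop

/-- The product of a test function with a coordinate function. -/
noncomputable def mulCoord {Ω : Opens Plane} (i : Fin 2) (ψ : 𝓓(Ω, ℝ)) : 𝓓(Ω, ℝ) :=
  cutoff Ω (fun x => x i) (contDiff_coord i) ψ ((tsupport_mul_subset_right).trans ψ.tsupport_subset)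

lemma mulCoord_apply {Ω : Opens Plane} (i : Fin 2) (ψ : 𝓓(Ω, ℝ)) (x : Plane) :
    mulCoord i ψ x = x i * ψ x := rfl

lemma partialDeriv_coord (i j : Fin 2) (x : Plane) :
    partialDeriv j (fun y : Plane => y i) x = if i = j then 1 else 0 := by
  have : HasFDerivAt (fun y : Plane => y i) (EuclideanSpace.proj i : Plane →L[ℝ] ℝ) x :=
    (EuclideanSpace.proj i : Plane →L[ℝ] ℝ).hasFDerivAt
  rw [partialDeriv, this.fderiv]
  simp [basisVec]

/-- The extra term `ψ` is what brings `E` itself, and not only its curl, into the first moments. -/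
lemma lineDeriv_mulCoord_self {Ω : Opens Plane} (i : Fin 2) (ψ : 𝓓(Ω, ℝ)) :
    ∂_{basisVec i} (mulCoord i ψ) = mulCoord i (∂_{basisVec i} ψ) + ψ := by
  ext x
  change (∂_{basisVec i} (mulCoord i ψ)) x = mulCoord i (∂_{basisVec i} ψ) x + ψ x
  rw [lineDeriv_testFunction_apply, mulCoord_apply, lineDeriv_testFunction_apply,
    show ⇑(mulCoord i ψ) = fun x => x i * ψ x from rfl,
    partialDeriv_mul ((contDiff_coord i).differentiable (by simp) x)
      (ψ.contDiff.differentiable (by simp) x), partialDeriv_coord]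
  simp

lemma lineDeriv_mulCoord_of_ne {Ω : Opens Plane} {i j : Fin 2} (h : i ≠ j) (ψ : 𝓓(Ω, ℝ)) :
    ∂_{basisVec j} (mulCoord i ψ) = mulCoord i (∂_{basisVec j} ψ) := by
  ext x
  rw [lineDeriv_testFunction_apply, mulCoord_apply, lineDeriv_testFunction_apply,
    show ⇑(mulCoord i ψ) = fun x => x i * ψ x from rfl,
    partialDeriv_mul ((contDiff_coord i).differentiable (by simp) x)
      (ψ.contDiff.differentiable (by simp) x), partialDeriv_coord]
  simp [h]

lemma distCurl_apply {Ω : Opens Plane} (v : VectorDistribution Ω) (ψ : 𝓓(Ω, ℝ)) :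
    distCurl v ψ = v 0 (∂_{basisVec 1} ψ) - v 1 (∂_{basisVec 0} ψ) := by
  have h : distCurl v ψ = (∂_{basisVec 0} (v 1) : 𝓓'(Ω, ℝ)) ψ - (∂_{basisVec 1} (v 0) : 𝓓'(Ω, ℝ)) ψ :=
    rfl
  rw [h, lineDeriv_distribution_apply, lineDeriv_distribution_apply]
  ring

/-! ### The one-forms of the Cesàro integral -/

/-- The rows `E₀ + y₂ curl E` and `E₁ - y₁ curl E` of the Cesàro integrand with base point `O`. -/
noncomputable def cesaroForm (F : Plane → Matrix (Fin 2) (Fin 2) ℝ) (i : Fin 2) (y : Plane) :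
    Fin 2 → ℝ :=
  fun j => F y i j + crossE₃ y i * curlTensor F y j

lemma cesaroForm_zero (F : Plane → Matrix (Fin 2) (Fin 2) ℝ) (y : Plane) (j : Fin 2) :
    cesaroForm F 0 y j = F y 0 j + y 1 * curlTensor F y j := rfl

lemma cesaroForm_one (F : Plane → Matrix (Fin 2) (Fin 2) ℝ) (y : Plane) (j : Fin 2) :
    cesaroForm F 1 y j = F y 1 j + -y 0 * curlTensor F y j := rfl

lemma contDiff_crossE₃ (i : Fin 2) : ContDiff ℝ ∞ fun y : Plane => crossE₃ y i := by
  fin_cases i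
  · exact contDiff_coord 1
  · exact (contDiff_coord 0).neg

section Regular

variable {Ω : Opens Plane} {E : TensorDistribution Ω} {E₀ : Plane → Matrix (Fin 2) (Fin 2) ℝ}

lemma IsRegularPart.contDiffOn_cesaroForm (h : IsRegularPart E E₀) (i j : Fin 2) :
    ContDiffOn ℝ ∞ (fun x => cesaroForm E₀ i x j) (puncture Ω) :=
  (h i j).1.add ((contDiff_crossE₃ i).contDiffOn.mul (h.density_curlTensor j).1)

/-- By the product rule the curl of row `i` is (curl E₀)ᵢ, plus the coefficient `crossE₃ y i` times
curl curl E₀, plus the wedge of the gradient of that coefficient with curl E₀. The last term is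
-(curl E₀)ᵢ, so only the multiple of curl curl E₀ survives. -/
lemma IsRegularPart.curl_cesaroForm (h : IsRegularPart E E₀) (hc : IsCurlCurlFree Ω E₀) (i : Fin 2)
    {x : Plane} (hx : x ∈ puncture Ω) : curl (cesaroForm E₀ i) x = 0 := by
  have hV := (puncture Ω).isOpen.mem_nhds hx
  have hE : ∀ j, DifferentiableAt ℝ (fun y => E₀ y i j) x := fun j =>
    ((h i j).1.contDiffAt hV).differentiableAt (by simp)
  have hC : ∀ j, DifferentiableAt ℝ (fun y => curlTensor E₀ y j) x := fun j =>
    ((h.density_curlTensor j).1.contDiffAt hV).differentiableAt (by simp)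
  have hX : DifferentiableAt ℝ (fun y : Plane => crossE₃ y i) x :=
    (contDiff_crossE₃ i).differentiable (by simp) x
  have hpd : ∀ k j, partialDeriv k (fun y => cesaroForm E₀ i y j) x =
      partialDeriv k (fun y => E₀ y i j) x + (crossE₃ x i * partialDeriv k (fun y => curlTensor E₀ y j) x +
        partialDeriv k (fun y => crossE₃ y i) x * curlTensor E₀ x j) := fun k j => by
    rw [← partialDeriv_mul hX (hC j)]
    exact partialDeriv_add (hE j) (hX.fun_mul (hC j)) k
  have hcc : partialDeriv 0 (fun y => curlTensor E₀ y 1) x -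
      partialDeriv 1 (fun y => curlTensor E₀ y 0) x = 0 := hc x hx
  have hrow : partialDeriv 0 (fun y => E₀ y i 1) x - partialDeriv 1 (fun y => E₀ y i 0) x =
      curlTensor E₀ x i := rfl
  rw [curl, hpd, hpd]
  have hcross : partialDeriv 0 (fun y : Plane => crossE₃ y i) x * curlTensor E₀ x 1 -
      partialDeriv 1 (fun y : Plane => crossE₃ y i) x * curlTensor E₀ x 0 = -curlTensor E₀ x i := by
    have hneg : ∀ k, partialDeriv k (fun y : Plane => -y 0) x = -partialDeriv k (fun y => y 0) x :=
      fun k => by simp only [partialDeriv, fderiv_fun_neg]; rfl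
    fin_cases i
    · change partialDeriv 0 (fun y : Plane => y 1) x * _ - partialDeriv 1 (fun y : Plane => y 1) x * _ = _
      simp [partialDeriv_coord]
    · change partialDeriv 0 (fun y : Plane => -y 0) x * _ -
        partialDeriv 1 (fun y : Plane => -y 0) x * _ = _
      simp [hneg, partialDeriv_coord]
  linear_combination crossE₃ x i * hcc + hrow + hcross

lemma continuous_loopIntegrand {w : Plane → Fin 2 → ℝ}
    (hw : ∀ i, ContinuousOn (fun x => w x i) (puncture Ω)) {ε : ℝ} (hε : 0 < ε)
    (h : Metric.closedBall (0 : Plane) ε ⊆ Ω) :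
    Continuous fun θ => w (circlePoint ε θ) 0 * -(ε * Real.sin θ) +
      w (circlePoint ε θ) 1 * (ε * Real.cos θ) := by
  have hc : ∀ i, Continuous fun θ => w (circlePoint ε θ) i := fun i =>
    (hw i).comp_continuous (continuous_circlePoint.comp (by fun_prop : Continuous fun θ => (ε, θ)))
      fun θ => mem_puncture_of_norm h ((norm_circlePoint hε.le θ).symm ▸ hε)
        (norm_circlePoint hε.le θ).le
  exact ((hc 0).mul (by fun_prop)).add ((hc 1).mul (by fun_prop))

/-- Linearity of `crossE₃` takes the base point out of the integral, which is thus affine in `x`. -/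
lemma IsRegularPart.cesaroIntegral_eq (h : IsRegularPart E E₀) {ε : ℝ} (hε : 0 < ε)
    (hball : Metric.closedBall (0 : Plane) ε ⊆ Ω) (x : Plane) (i : Fin 2) :
    cesaroIntegral E₀ ε x i =
      loopIntegral (cesaroForm E₀ i) ε - crossE₃ x i * loopIntegral (curlTensor E₀) ε := by
  have h1 := continuous_loopIntegrand (fun j => (h.contDiffOn_cesaroForm i j).continuousOn) hε hball
  have h2 := continuous_loopIntegrand (fun j => (h.density_curlTensor j).1.continuousOn) hε hball
  rw [loopIntegral, loopIntegral, ← intervalIntegral.integral_const_mul,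
    ← intervalIntegral.integral_sub (h1.intervalIntegrable _ _)
      ((h2.intervalIntegrable _ _).const_mul _)]
  refine intervalIntegral.integral_congr fun θ _ => ?_
  have hcross : ∀ y : Plane, crossE₃ (y - x) i = crossE₃ y i - crossE₃ x i := fun y => by
    fin_cases i <;> simp [crossE₃]
    ring
  simp only [cesaroIntegrand, Matrix.mulVec, dotProduct, Fin.sum_univ_two, Matrix.add_apply,
    Matrix.vecMulVec_apply, hcross, circleVelocity, cesaroForm, Matrix.cons_val_zero,
    Matrix.cons_val_one, Matrix.cons_val_fin_one]
  ring

/-- The Cesàro integral vanishes for all base points iff its three moments vanish. -/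
lemma IsRegularPart.cesaroVanishes_iff (h : IsRegularPart E E₀) {ε : ℝ} (hε : 0 < ε)
    (hball : Metric.closedBall (0 : Plane) ε ⊆ Ω) :
    CesaroVanishes Ω E₀ ε ↔ loopIntegral (curlTensor E₀) ε = 0 ∧
      ∀ i, loopIntegral (cesaroForm E₀ i) ε = 0 := by
  constructor
  · intro hv
    -- The origin is not an admissible base point, so the coefficients are read off from the two
    -- points `(0, ε)` and `(0, ε / 2)`: subtracting the component-0 equations isolates the
    -- circulation of curl E₀.
    have hcirc : ∀ c, 0 < c → c ≤ ε → ∀ i, loopIntegral (cesaroForm E₀ i) ε -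
        crossE₃ (circlePoint c (Real.pi / 2)) i * loopIntegral (curlTensor E₀) ε = 0 := by
      intro c hc hcε i
      have hn := norm_circlePoint hc.le (Real.pi / 2)
      rw [← h.cesaroIntegral_eq hε hball, hv _ (mem_puncture_of_norm hball (by rwa [hn]) (by rwa [hn]))]
      rfl
    have h1 := hcirc ε hε le_rfl
    have h2 := hcirc (ε / 2) (half_pos hε) (half_le_self hε.le)
    have hc : loopIntegral (curlTensor E₀) ε = 0 := by
      have h10 := h1 0
      have h20 := h2 0
      simp only [crossE₃, circlePoint, Matrix.cons_val_zero, Matrix.cons_val_one,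
        Matrix.cons_val_fin_one, Real.sin_pi_div_two, mul_one] at h10 h20
      have : ε * loopIntegral (curlTensor E₀) ε = 0 := by linarith
      exact (mul_eq_zero.1 this).resolve_left hε.ne'
    exact ⟨hc, fun i => by simpa [hc] using h1 i⟩
  · rintro ⟨hc, hi⟩ x -
    ext i
    rw [h.cesaroIntegral_eq hε hball, hc, hi]
    simp

end Regular

/-! ### The moments of `Curl Curl E` -/

lemma IsCutoff.lineDeriv_eventuallyEq_zero {Ω : Opens Plane} {ε R : ℝ} {χ : 𝓓(Ω, ℝ)}
    (hχ : IsCutoff ε R χ) (i : Fin 2) : (∂_{basisVec i} χ : 𝓓(Ω, ℝ)) =ᶠ[𝓝 0] fun _ => 0 := by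
  filter_upwards [Metric.closedBall_mem_nhds (0 : Plane) hχ.pos] with x hx
  rw [lineDeriv_testFunction_apply]
  exact partialDeriv_eq_zero_of_eventuallyEq (hχ.one x (mem_closedBall_zero_iff.1 hx)) i

lemma mulCoord_eventuallyEq_zero {Ω : Opens Plane} {ψ : 𝓓(Ω, ℝ)} (h : ψ =ᶠ[𝓝 0] fun _ => 0)
    (i : Fin 2) : mulCoord i ψ =ᶠ[𝓝 0] fun _ => 0 := by
  filter_upwards [h] with x hx
  rw [mulCoord_apply, hx, mul_zero]

section Moments

variable {Ω : Opens Plane} {E : TensorDistribution Ω} {E₀ : Plane → Matrix (Fin 2) (Fin 2) ℝ}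
  {ε R : ℝ} {χ : 𝓓(Ω, ℝ)}

/-- The outer curl falls on χ, whose derivatives vanish near the origin; the pairing becomes the
wedge integral of dχ with the closed form curl E₀. -/
theorem IsRegularPart.distCurlCurl_cutoff (h : IsRegularPart E E₀) (hc : IsCurlCurlFree Ω E₀)
    (hχ : IsCutoff ε R χ) : distCurlCurl E χ = loopIntegral (curlTensor E₀) ε := by
  have hz := hχ.lineDeriv_eventuallyEq_zero
  have hw := hχ.integral_wedge (fun i => (h.density_curlTensor i).1) hc
  have hi : ∀ j k, Integrable fun x => curlTensor E₀ x j * (∂_{basisVec k} χ : 𝓓(Ω, ℝ)) x :=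
    fun j k => integrable_of_eventuallyEq_zero (h.density_curlTensor j).1.continuousOn (hz k)
  rw [distCurlCurl, distCurl_apply, apply_eq_integral (h.density_curlTensor 0) (hz 1),
    apply_eq_integral (h.density_curlTensor 1) (hz 0), ← integral_sub (hi 0 1) (hi 1 0),
    ← neg_neg (loopIntegral _ _), ← hw, ← integral_neg]
  simp_rw [lineDeriv_testFunction_apply, neg_sub]

lemma IsRegularPart.integrable_cesaroForm (h : IsRegularPart E E₀) (hχ : IsCutoff ε R χ)
    (i j k : Fin 2) :
    Integrable fun x => cesaroForm E₀ i x j * (∂_{basisVec k} χ : 𝓓(Ω, ℝ)) x :=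
  integrable_of_eventuallyEq_zero (h.contDiffOn_cesaroForm i j).continuousOn
    (hχ.lineDeriv_eventuallyEq_zero k)

lemma IsRegularPart.loopIntegral_cesaroForm (h : IsRegularPart E E₀) (hc : IsCurlCurlFree Ω E₀)
    (hχ : IsCutoff ε R χ) (i : Fin 2) :
    loopIntegral (cesaroForm E₀ i) ε =
      (∫ x, cesaroForm E₀ i x 0 * (∂_{basisVec 1} χ : 𝓓(Ω, ℝ)) x) -
        ∫ x, cesaroForm E₀ i x 1 * (∂_{basisVec 0} χ : 𝓓(Ω, ℝ)) x := by
  have hw := hχ.integral_wedge (h.contDiffOn_cesaroForm i) fun x hx => h.curl_cesaroForm hc i hx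
  rw [← integral_sub (h.integrable_cesaroForm hχ i 0 1) (h.integrable_cesaroForm hχ i 1 0),
    ← neg_neg (loopIntegral _ _), ← hw, ← integral_neg]
  simp_rw [lineDeriv_testFunction_apply, neg_sub]

/-- Rewrites the wedge integrals as values of `E` and its curl, which can then be matched with the
expansion of the first moments. The opposite signs in the two rows are those of `crossE₃`. -/
lemma IsRegularPart.integral_cesaroForm (h : IsRegularPart E E₀) (hχ : IsCutoff ε R χ)
    (j k : Fin 2) :
    (∫ x, cesaroForm E₀ 0 x j * (∂_{basisVec k} χ : 𝓓(Ω, ℝ)) x) =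
        E 0 j (∂_{basisVec k} χ) + distCurlTensor E j (mulCoord 1 (∂_{basisVec k} χ)) ∧
      (∫ x, cesaroForm E₀ 1 x j * (∂_{basisVec k} χ : 𝓓(Ω, ℝ)) x) =
        E 1 j (∂_{basisVec k} χ) - distCurlTensor E j (mulCoord 0 (∂_{basisVec k} χ)) := by
  have hz := hχ.lineDeriv_eventuallyEq_zero k
  have hz' := mulCoord_eventuallyEq_zero hz
  have hE := fun i => integrable_of_eventuallyEq_zero (h i j).1.continuousOn hz
  have hC := fun i =>
    integrable_of_eventuallyEq_zero (h.density_curlTensor j).1.continuousOn (hz' i)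
  rw [apply_eq_integral (h 0 j) hz, apply_eq_integral (h 1 j) hz,
    apply_eq_integral (h.density_curlTensor j) (hz' 0),
    apply_eq_integral (h.density_curlTensor j) (hz' 1), ← integral_add (hE 0) (hC 1),
    ← integral_sub (hE 1) (hC 0)]
  constructor <;> refine integral_congr_ae (Eventually.of_forall fun x => ?_)
  · simp only [cesaroForm_zero, mulCoord_apply]
    ring
  · simp only [cesaroForm_one, mulCoord_apply]
    ring

/-- In the expansion of the moment, differentiating the coordinate leaves `distCurlTensor E 0 χ`.
One more integration by parts turns it into the row `E 0` paired with derivatives of χ, the missing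
part of the Cesàro form. -/
theorem IsRegularPart.distCurlCurl_mulCoord_one (h : IsRegularPart E E₀)
    (hc : IsCurlCurlFree Ω E₀) (hχ : IsCutoff ε R χ) :
    distCurlCurl E (mulCoord 1 χ) = loopIntegral (cesaroForm E₀ 0) ε := by
  rw [h.loopIntegral_cesaroForm hc hχ, (h.integral_cesaroForm hχ 0 1).1,
    (h.integral_cesaroForm hχ 1 0).1, distCurlCurl, distCurl_apply, lineDeriv_mulCoord_self,
    lineDeriv_mulCoord_of_ne (by decide), map_add]
  have : distCurlTensor E 0 χ = E 0 0 (∂_{basisVec 1} χ) - E 0 1 (∂_{basisVec 0} χ) :=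
    distCurl_apply _ _
  rw [this]
  ring

theorem IsRegularPart.distCurlCurl_mulCoord_zero (h : IsRegularPart E E₀)
    (hc : IsCurlCurlFree Ω E₀) (hχ : IsCutoff ε R χ) :
    distCurlCurl E (mulCoord 0 χ) = -loopIntegral (cesaroForm E₀ 1) ε := by
  rw [h.loopIntegral_cesaroForm hc hχ, (h.integral_cesaroForm hχ 0 1).2,
    (h.integral_cesaroForm hχ 1 0).2, distCurlCurl, distCurl_apply, lineDeriv_mulCoord_self,
    lineDeriv_mulCoord_of_ne (by decide), map_add]
  have : distCurlTensor E 1 χ = E 1 0 (∂_{basisVec 1} χ) - E 1 1 (∂_{basisVec 0} χ) :=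
    distCurl_apply _ _
  rw [this]
  ring

theorem IsRegularPart.cesaroVanishes_iff_moments (h : IsRegularPart E E₀)
    (hc : IsCurlCurlFree Ω E₀) (hχ : IsCutoff ε R χ)
    (hball : Metric.closedBall (0 : Plane) ε ⊆ Ω) :
    CesaroVanishes Ω E₀ ε ↔
      distCurlCurl E χ = 0 ∧ ∀ i, distCurlCurl E (mulCoord i χ) = 0 := by
  rw [h.cesaroVanishes_iff hχ.pos hball, Fin.forall_fin_two, Fin.forall_fin_two,
    h.distCurlCurl_cutoff hc hχ, h.distCurlCurl_mulCoord_zero hc hχ,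
    h.distCurlCurl_mulCoord_one hc hχ, neg_eq_zero, and_comm (a := loopIntegral (cesaroForm E₀ 0) ε = 0)]

end Moments

/-! ### Reduction to moments and the main theorem -/

/-- A distribution that annihilates the test functions vanishing to first order at the origin is
determined by its moments of degree at most one. -/
lemma eq_zero_of_moments {Ω : Opens Plane} {T : 𝓓'(Ω, ℝ)} {ε R : ℝ} {χ : 𝓓(Ω, ℝ)}
    (hχ : IsCutoff ε R χ)
    (hT : ∀ ψ : 𝓓(Ω, ℝ), (∀ j < 2, iteratedFDeriv ℝ j ψ 0 = 0) → T ψ = 0)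
    (h0 : T χ = 0) (h1 : ∀ i, T (mulCoord i χ) = 0) : T = 0 := by
  ext ψ
  let a : Fin 2 → ℝ := fun i => partialDeriv i ψ 0
  -- As χ is one near the origin, `φ` is there the remainder of the first-order Taylor polynomial of
  -- `ψ`.
  let φ : 𝓓(Ω, ℝ) := ψ - (ψ 0 • χ + (a 0 • mulCoord 0 χ + a 1 • mulCoord 1 χ))
  have hφ : ⇑φ =ᶠ[𝓝 0] fun x => ψ x - (ψ 0 + (a 0 * x 0 + a 1 * x 1)) := by
    filter_upwards [hχ.one 0 (by simpa using hχ.pos.le)] with x hx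
    change ψ x - (ψ 0 * χ x + (a 0 * (x 0 * χ x) + a 1 * (x 1 * χ x))) = _
    rw [hx]
    ring
  have hTφ : T φ = 0 := by
    refine hT φ fun j hj => ?_
    have hf : fderiv ℝ φ 0 = 0 := by
      rw [hφ.fderiv_eq]
      have hlin : HasFDerivAt (fun x : Plane => ψ 0 + (a 0 * x 0 + a 1 * x 1))
          (a 0 • (EuclideanSpace.proj 0 : Plane →L[ℝ] ℝ) +
            a 1 • (EuclideanSpace.proj 1 : Plane →L[ℝ] ℝ)) 0 :=
        (((EuclideanSpace.proj 0 : Plane →L[ℝ] ℝ).hasFDerivAt.const_mul (a 0)).add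
          ((EuclideanSpace.proj 1 : Plane →L[ℝ] ℝ).hasFDerivAt.const_mul (a 1))).const_add _
      have hψ : HasFDerivAt ψ (fderiv ℝ ψ 0) 0 :=
        (ψ.contDiff.differentiable (by simp) 0).hasFDerivAt
      rw [(hψ.fun_sub hlin).fderiv]
      ext v
      have hv : v = v 0 • basisVec 0 + v 1 • basisVec 1 := by
        ext i
        fin_cases i <;> simp [basisVec]
      have : fderiv ℝ ψ 0 v = v 0 * a 0 + v 1 * a 1 := by
        conv_lhs => rw [hv]
        simp [a, partialDeriv]
      simp [this]
      ring
    interval_cases j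
    · rw [← norm_eq_zero, norm_iteratedFDeriv_zero, hφ.eq_of_nhds]
      simp
    · rw [← norm_eq_zero, norm_iteratedFDeriv_one, hf, norm_zero]
  have hsplit : T φ = T ψ - (ψ 0 * T χ + (a 0 * T (mulCoord 0 χ) + a 1 * T (mulCoord 1 χ))) := by
    simp only [φ, map_sub, map_add, map_smul, smul_eq_mul]
  rw [hTφ, h0, h1, h1] at hsplit
  simpa using hsplit.symm

/-- A strict bound on the infimum yields an actual exponent below the bound, whether or not the
infimum is attained or finite. -/
lemma exists_scalesToZero_of_degree_lt {Ω : Opens Plane} {E : TensorDistribution Ω} {d : ℝ}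
    (h : degree E < (d : EReal)) : ∃ k : ℝ, k < d + 2 ∧ ∀ i j, ScalesToZero (E i j) k := by
  have h1 : scalingDegree E < ((d + 2 : ℝ) : EReal) := by
    rw [degree, EReal.sub_lt_iff (.inl (EReal.coe_ne_bot _)) (.inl (EReal.coe_ne_top _))] at h
    exact_mod_cast h
  obtain ⟨-, ⟨k, hk, rfl⟩, hlt⟩ := sInf_lt_iff.1 h1
  exact ⟨k, EReal.coe_lt_coe_iff.1 hlt, hk⟩

end PlanarStrain

theorem mainTheorem7 (Ω : Opens PlanarStrain.Plane)
    (hΩ : IsSimplyConnected (Ω : Set PlanarStrain.Plane)) (hO : (0 : PlanarStrain.Plane) ∈ Ω)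
    (E : PlanarStrain.TensorDistribution Ω) (hsymm : E.IsSymm)
    (hE : PlanarStrain.IsSingularField E) :
    (∃ E₀ : PlanarStrain.Plane → Matrix (Fin 2) (Fin 2) ℝ, PlanarStrain.IsRegularPart E E₀) ∧
    ∀ E₀ : PlanarStrain.Plane → Matrix (Fin 2) (Fin 2) ℝ, PlanarStrain.IsRegularPart E E₀ →
      ∀ ε : ℝ, 0 < ε → Metric.closedBall (0 : PlanarStrain.Plane) ε ⊆ Ω →
        (PlanarStrain.distCurlCurl E = 0 →
          PlanarStrain.IsCurlCurlFree Ω E₀ ∧ PlanarStrain.CesaroVanishes Ω E₀ ε) ∧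
        (PlanarStrain.degree E < ((-2 : ℝ) : EReal) →
          (PlanarStrain.distCurlCurl E = 0 ↔ PlanarStrain.IsCurlCurlFree Ω E₀)) ∧
        (((-2 : ℝ) : EReal) ≤ PlanarStrain.degree E → PlanarStrain.degree E < 0 →
          (PlanarStrain.distCurlCurl E = 0 ↔
            PlanarStrain.IsCurlCurlFree Ω E₀ ∧ PlanarStrain.CesaroVanishes Ω E₀ ε)) := by
  refine ⟨PlanarStrain.exists_isRegularPart hE, fun E₀ h ε hε hball => ?_⟩
  obtain ⟨R, χ, hχ⟩ := PlanarStrain.exists_isCutoff hε hball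
  have hnec : PlanarStrain.distCurlCurl E = 0 →
      PlanarStrain.IsCurlCurlFree Ω E₀ ∧ PlanarStrain.CesaroVanishes Ω E₀ ε := fun hC => by
    have hc : PlanarStrain.IsCurlCurlFree Ω E₀ := by
      rw [h.isCurlCurlFree_iff, hC]
      exact map_zero _
    refine ⟨hc, (h.cesaroVanishes_iff_moments hc hχ hball).2 ?_⟩
    rw [hC]
    exact ⟨rfl, fun _ => rfl⟩
  refine ⟨hnec, fun hdeg => ⟨fun hC => (hnec hC).1, fun hc => ?_⟩,
    fun _ hdeg => ⟨hnec, fun ⟨hc, hv⟩ => ?_⟩⟩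
  -- Here `k < 0`, so Curl Curl E scales with exponent `k + 2 < 2` and `d = 0` imposes no condition
  -- on `ψ`.
  · obtain ⟨k, hk, hE0⟩ := PlanarStrain.exists_scalesToZero_of_degree_lt hdeg
    ext ψ
    exact (PlanarStrain.scalesToZero_distCurlCurl hE0).apply_eq_zero (h.isCurlCurlFree_iff.1 hc)
      (d := 0) (by push_cast; linarith) ψ (by simp)
  -- Here `k < 2`, so the exponent is `k + 2 < 4 = 2 + d` with `d = 2`: only moments of degree at
  -- most one remain, and (ii) makes them vanish.
  · obtain ⟨k, hk, hE0⟩ := PlanarStrain.exists_scalesToZero_of_degree_lt (d := 0) (by exact_mod_cast hdeg)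
    obtain ⟨h0, h1⟩ := (h.cesaroVanishes_iff_moments hc hχ hball).1 hv
    exact PlanarStrain.eq_zero_of_moments hχ
      (fun ψ => (PlanarStrain.scalesToZero_distCurlCurl hE0).apply_eq_zero
        (h.isCurlCurlFree_iff.1 hc) (d := 2) (by push_cast; linarith) ψ) h0 h1
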